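/- **Setting.** A source, a half-duplex relay and a destination communicate over quasi-static Rayleigh fading: the source–relay, source–destination and relay–destination gains $h, g_1, g_2$ are i.i.d. $\mathcal{CN}(0,1)$ and constant over a block of $M\ge 1$ slots of $T\ge1$ symbols. Fix noise variances $\sigma_v^2,\sigma_w^2>0$ (relay, destination), and put $\rho=E/\sigma_w^2$, $\rho'=E/\sigma_v^2$, where $E$ is the symbol energy. A Dynamic Decode and Forward (DDF) scheme at SNR $\rho$ consists of a source code and a relay code, each indexed by $K\ge 2$ equiprobable messages, of length $MT$ and rate $R=\frac{\log K}{MT}$; a causal relay rule, which from $h$ and the received signal $y_{r,k}=hx_{s,k}+v_k$ of the first $m$ slots determines whether the decision time is $\mathcal M=m\in\{1,\dots,M\}$, and on which message $\widehat\omega$ the relay then decides; and a destination decoder that knows $g_1,g_2$. The destination receives $y_k=g_1x_{s,k}+w_k$ for $k\le \mathcal MT$ and $y_k=g_1x_{s,k}+g_2x_{r,k}(\widehat\omega)+w_k$ for $\mathcal MT<k\le MT$, with independent white noises $v_k\sim\mathcal{CN}(0,\sigma_v^2)$, $w_k\sim\mathcal{CN}(0,\sigma_w^2)$. The relay never decides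 while in outage: $\mathcal M\ge\mathcal M_0$, where $\mathcal M_0=\mathcal M_0(h)$ is the least $m\in\{1,\dots,M-1\}$ with $m\log(1+|h|^2\rho')>MR$, and $\mathcal M_0=M$ if there is none. Each symbol sent by the source has average energy at most $E$ over the messages, and each symbol actually sent by the relay (zero up to the decision time) has, for each value of $h$, average energy at most $E$ over the messages and the relay noise. A family of schemes indexed by $\rho$ with error probability $P_e(\rho)$ at the destination has multiplexing gain $r$ and diversity gain $d\in[-\infty,\infty]$ if $R(\rho)/\log\rho\to r$ and $-\log P_e(\rho)/\log\rho\to d$ as $\rho\to\infty$. Let $d^*_M(r)$ be the supremum of the diversity gains of families with multiplexing gain $r$ whose destination is not told $\mathcal M$, and $d^{\rm genie}_M(r)$ the same supremum when the destination may use $\mathcal M$. **Theorem 1.** For $0\le r\le1$, $$d^*_M(r)\le d_{\rm out}(r)\quad\text{and}\quad d^{\rm genie}_M(r)\le d_{\rm out}(r),\qquad d_{\rm out}(r)=\min_{1\le m\le M}\{\overline d_m(r)+d_m(r)\},$$ where $$\overline d_m(r)=\begin{cases}1-\frac{Mr}{m-1},&m\ge 2,\ 0\le r\le\frac{m-1}M,\\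 0,&\frac{m-1}M<r\le\frac mM,\ \text{or } m=1,\ 0\le r\le \frac1M,\\ \infty,&\frac mM<r\le1,\end{cases}$$ $$d_m(r)=\begin{cases}2-2r,&m<\frac M2,\\ \frac{M(1-r)}m,&m\ge\frac M2,\end{cases}\quad\text{for } r\ge\tfrac12,\qquad d_m(r)=\begin{cases}2-2r,&m<\frac M2,\\ 2-\frac{rM}{M-m},&\frac M2\le m<M(1-r),\\ \frac{M(1-r)}m,&m\ge \frac M2,\ m\ge M(1-r),\end{cases}\quad\text{for } r<\tfrac12.$$ Moreover, let $0<r\le1$ and $R=r\log\rho$, and write $P\doteq\rho^{-d}$ for $-\log P/\log\rho\to d$ as $\rho\to\infty$. For $1\le m\le M$ let $\mathcal I_m=mT\log(1+|g_1|^2\rho)+(M-m)T\log(1+(|g_1|^2+|g_2|^2)\rho)$ be the mutual information of the $m$-switch parallel channel. Then, for $1\le m\le M$, $$P(\mathcal M_0=m)\doteq\rho^{-\overline d_m(r)},\qquad P(\mathcal I_m\le MTR)\doteq\rho^{-d_m(r)},\qquad\text{and}\qquad P(\mathcal I_{\mathcal M_0}\le MTR)\doteq\rho^{-d_{\rm out}(r)}.$$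 -/

import Mathlib

open MeasureTheory ProbabilityTheory Filter Topology
open scoped ENNReal NNReal

noncomputable section

namespace DDF

/-- The circularly symmetric complex Gaussian law `CN(0, s)`: independent real and imaginary
parts, each centred Gaussian of variance `s / 2`. -/
def complexNormal (s : ℝ≥0) : Measure ℂ :=
  ((gaussianReal 0 (s / 2)).prod (gaussianReal 0 (s / 2))).map
    (fun p : ℝ × ℝ => (⟨p.1, p.2⟩ : ℂ))

/-- A block of `M` slots of `T` complex symbols. Slots are indexed from `0`, so that index `i`
is slot number `i + 1`. -/
abbrev Block (M T : ℕ) : Type := Fin M → Fin T → ℂ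

/-- White noise of variance `s` per symbol. -/
def noiseLaw (M T : ℕ) (s : ℝ≥0) : Measure (Block M T) :=
  Measure.pi fun _ : Fin M => Measure.pi fun _ : Fin T => complexNormal s

/-- The negative `ρ`-exponent `- log P / log ρ` of a probability `P`; it is `+∞` if `P = 0`. -/
def snrExponent (ρ : ℝ) (P : ℝ≥0∞) : EReal :=
  -(ENNReal.log P) / ((Real.log ρ : ℝ) : EReal)

/-- The outage-based decision time: the least `m` in `{1, …, M - 1}` with
`m log (1 + |h|² ρ') > M R`, and `M` if there is none (rates in nats per symbol). -/
def outageTime (M : ℕ) (R ρ' : ℝ) (h : ℂ) : ℕ :=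
  sInf {m : ℕ | m = M ∨
    (1 ≤ m ∧ (M : ℝ) * R < (m : ℝ) * Real.log (1 + ‖h‖ ^ 2 * ρ'))}

/-- A coding scheme for the dynamic decode and forward protocol with `M` slots of length `T`, at
SNR `ρ = E / σ_w²`, where `sw = σ_w²` and `sv = σ_v²` are the noise variances at the destination
and at the relay. Hence `E = ρ * sw`, and the source-relay SNR is `ρ' = ρ * sw / sv`. -/
structure Scheme (M T : ℕ) (sw sv : ℝ≥0) (ρ : ℝ) where
  /-- The number of messages. -/
  K : ℕ
  two_le_K : 2 ≤ K
  /-- The source code. -/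
  xs : Fin K → Block M T
  /-- The auxiliary code of the relay. -/
  xr : Fin K → Block M T
  /-- The decision time, as a function of the source-relay gain and the signal received by
  the relay. -/
  time : ℂ → Block M T → ℕ
  /-- The message on which the relay decides. -/
  relayMsg : ℂ → Block M T → Fin K
  /-- The destination decoder: decision time (for a destination that is told it), the two channel
  gains towards the destination, received block. -/
  dest : ℕ → ℂ → ℂ → Block M T → Fin K
  measurable_time : Measurable fun p : ℂ × Block M T => time p.1 p.2
  measurable_relayMsg : Measurable fun p : ℂ × Block M T => relayMsg p.1 p.2
  measurable_dest : ∀ m, Measurable fun p : ℂ × ℂ × Block M T => dest m p.1 p.2.1 p.2.2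
  time_le : ∀ h y, time h y ≤ M
  /-- Causality: whether the relay decides at the end of slot `m`, and on which message, depends
  only on what it has received up to the end of slot `m`. -/
  causal : ∀ h y y', (∀ i : Fin M, (i : ℕ) < time h y → y i = y' i) →
    time h y' = time h y ∧ relayMsg h y' = relayMsg h y
  /-- The relay does not decide while the source-relay link is in outage. -/
  outageTime_le : ∀ h y,
    outageTime M (Real.log K / ((M : ℝ) * T)) (ρ * sw / sv) h ≤ time h y
  /-- Power constraint of the source, per symbol, averaged over the messages. -/
  source_power : ∀ i t,
    (K : ℝ≥0∞)⁻¹ * ∑ ω, ‖xs ω i t‖ₑ ^ 2 ≤ ENNReal.ofReal (ρ * sw)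
  /-- Power constraint of the relay, per symbol: it concerns the symbol that is really sent (zero
  up to the decision time), averaged over the messages and the relay noise, for each value of
  the gain `h`. -/
  relay_power : ∀ (h : ℂ) (i : Fin M) (t : Fin T),
    (K : ℝ≥0∞)⁻¹ * ∑ ω, ∫⁻ v,
      ‖(if time h (fun j s => h * xs ω j s + v j s) ≤ (i : ℕ)
        then xr (relayMsg h (fun j s => h * xs ω j s + v j s)) i t else 0)‖ₑ ^ 2
      ∂(noiseLaw M T sv) ≤ ENNReal.ofReal (ρ * sw)

namespace Scheme

variable {M T : ℕ} {sw sv : ℝ≥0} {ρ : ℝ}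

/-- The rate, in nats per symbol. -/
def rate (C : Scheme M T sw sv ρ) : ℝ := Real.log C.K / ((M : ℝ) * T)

/-- The signal received by the relay (of which it only uses the part before its decision). -/
def relayInput (C : Scheme M T sw sv ρ) (ω : Fin C.K) (h : ℂ) (v : Block M T) : Block M T :=
  fun i t => h * C.xs ω i t + v i t

/-- The signal sent by the relay: nothing up to the decision time, then the end of the codeword
of the decided message. -/
def relayOutput (C : Scheme M T sw sv ρ) (ω : Fin C.K) (h : ℂ) (v : Block M T) : Block M T :=
  fun i t => if C.time h (C.relayInput ω h v) ≤ (i : ℕ)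
    then C.xr (C.relayMsg h (C.relayInput ω h v)) i t else 0

/-- The signal received by the destination. -/
def destInput (C : Scheme M T sw sv ρ) (ω : Fin C.K) (h g₁ g₂ : ℂ) (v w : Block M T) :
    Block M T :=
  fun i t => g₁ * C.xs ω i t + g₂ * C.relayOutput ω h v i t + w i t

/-- The law of `(h, g₁, g₂, v, w)`: i.i.d. Rayleigh fading and independent white noises. -/
def channelLaw (M T : ℕ) (sw sv : ℝ≥0) : Measure (ℂ × ℂ × ℂ × Block M T × Block M T) :=
  (complexNormal 1).prod ((complexNormal 1).prod ((complexNormal 1).prod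
    ((noiseLaw M T sv).prod (noiseLaw M T sw))))

/-- The error probability at the destination, for a uniformly distributed message. -/
def errorProb (C : Scheme M T sw sv ρ) : ℝ≥0∞ :=
  (C.K : ℝ≥0∞)⁻¹ * ∑ ω, channelLaw M T sw sv
    {c | C.dest (C.time c.1 (C.relayInput ω c.1 c.2.2.2.1)) c.2.1 c.2.2.1
      (C.destInput ω c.1 c.2.1 c.2.2.1 c.2.2.2.1 c.2.2.2.2) ≠ ω}

/-- The destination is not informed of the decision time. -/
def Uninformed (C : Scheme M T sw sv ρ) : Prop := ∀ m m', C.dest m = C.dest m'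

end Scheme

/-- The family of schemes `C`, one for each SNR, has multiplexing gain `r` and diversity
gain `d`. -/
def Achieves {M T : ℕ} {sw sv : ℝ≥0} (C : (ρ : ℝ) → Scheme M T sw sv ρ)
    (r : ℝ) (d : EReal) : Prop :=
  Tendsto (fun ρ => (C ρ).rate / Real.log ρ) atTop (𝓝 r) ∧
  Tendsto (fun ρ => snrExponent ρ (C ρ).errorProb) atTop (𝓝 d)

/-- The diversity-multiplexing tradeoff of the protocol: the supremum of the diversity gains at
multiplexing gain `r`, the destination not knowing the decision time. -/
def dmt (M T : ℕ) (sw sv : ℝ≥0) (r : ℝ) : EReal :=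
  sSup {d | ∃ C : (ρ : ℝ) → Scheme M T sw sv ρ, (∀ ρ, (C ρ).Uninformed) ∧ Achieves C r d}

/-- The same, for a destination to which a genie reveals the decision time. -/
def genieDmt (M T : ℕ) (sw sv : ℝ≥0) (r : ℝ) : EReal :=
  sSup {d | ∃ C : (ρ : ℝ) → Scheme M T sw sv ρ, Achieves C r d}

/-- The exponent `d̄_m(r)`, for `1 ≤ m ≤ M` and `0 ≤ r ≤ 1`. The first case does not occur
for `m = 1`, where `M r / (m - 1)` makes no sense. -/
def dBar (M m : ℕ) (r : ℝ) : EReal :=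
  if m ≠ 1 ∧ r ≤ ((m : ℝ) - 1) / M then ((1 - M * r / ((m : ℝ) - 1) : ℝ) : EReal)
  else if r ≤ (m : ℝ) / M then 0
  else ⊤

/-- The exponent `d_m(r)`, for `1 ≤ m ≤ M` and `0 ≤ r ≤ 1`. -/
def dSwitch (M m : ℕ) (r : ℝ) : ℝ :=
  if 1 / 2 ≤ r then
    if (m : ℝ) < M / 2 then 2 - 2 * r
    else M * (1 - r) / m
  else
    if (m : ℝ) < M / 2 then 2 - 2 * r
    else if (m : ℝ) < M * (1 - r) then 2 - r * M / ((M : ℝ) - m)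
    else M * (1 - r) / m

/-- `d_out(r)`, the minimum of `d̄_m(r) + d_m(r)` over `1 ≤ m ≤ M`. -/
def dOut (M : ℕ) (r : ℝ) : EReal :=
  ⨅ m ∈ Finset.Icc 1 M, dBar M m r + (dSwitch M m r : EReal)

/-- Mutual information (in nats, Gaussian inputs) of the `m`-switch channel: the source-destination
link for `m` slots, the composite link for the remaining `M - m`. -/
def switchInfo (M T m : ℕ) (ρ : ℝ) (g₁ g₂ : ℂ) : ℝ :=
  (m : ℝ) * T * Real.log (1 + ‖g₁‖ ^ 2 * ρ) +
    ((M : ℝ) - m) * T * Real.log (1 + (‖g₁‖ ^ 2 + ‖g₂‖ ^ 2) * ρ)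

/-- The probability that the outage-based decision time at rate `r log ρ` is `m`. -/
def timeProb (M : ℕ) (sw sv : ℝ≥0) (m : ℕ) (r ρ : ℝ) : ℝ≥0∞ :=
  complexNormal 1 {h | outageTime M (r * Real.log ρ) (ρ * sw / sv) h = m}

/-- The outage probability of the `m`-switch channel at rate `r log ρ`. -/
def switchOutageProb (M T m : ℕ) (r ρ : ℝ) : ℝ≥0∞ :=
  (complexNormal 1).prod (complexNormal 1)
    {g | switchInfo M T m ρ g.1 g.2 ≤ (M : ℝ) * T * (r * Real.log ρ)}

/-- The outage probability of the random switch channel at rate `r log ρ`: the switching instant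
is the outage-based decision time. -/
def outageProb (M T : ℕ) (sw sv : ℝ≥0) (r ρ : ℝ) : ℝ≥0∞ :=
  (complexNormal 1).prod ((complexNormal 1).prod (complexNormal 1))
    {c | switchInfo M T (outageTime M (r * Real.log ρ) (ρ * sw / sv) c.1) ρ c.2.1 c.2.2
      ≤ (M : ℝ) * T * (r * Real.log ρ)}

end DDF

end

noncomputable section

namespace DDF

/-! The converse is Fano's inequality on a box of bad gains. Take `|h|² ≲ ρ^(z-1)`, `|g₁|² ≤
ρ^(x-1)`, `|g₂|² ≤ ρ^(y-1)` with `x ≤ y` and all exponents in `[0, 1]`. A disc of squared radius `t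
≤ 1` has Gaussian mass of order `t`, so the box has probability of order `ρ^-(3-x-y-z)`. If `(m-1) z
< M r`, the source-relay link is in outage up to slot `m - 1`, the relay is silent during the first
`m` slots, and the destination gets about `(m x + (M-m) y) T log ρ` nats. If this is below `M T r
log ρ` by a fixed fraction, the destination errs with probability bounded away from zero
(`Scheme.fano`, `errorProb_decayLE_of_box`). The least cost `2 - x - y` is a linear program of value
`dSwitch`, and the cost `1 - z` can be kept below `dBar`. The strict inequalities come from
shrinking the exponents by `1 - η`, which needs `r > 0`; at `r = 0` the bound `K ≥ 2` takes over
(`errorProb_decayLE_of_direct_outage`).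

Fano's inequality is obtained in Gibbs' variational form: the true output law is compared with a
Gaussian law that does not depend on the message, so no entropy of a continuous variable appears. A
destination that knows the decision time amounts to at most `M + 1 - m` decoders, which costs a
bounded number of nats; hence the genie does not change the bound.

For the outage exponents, the event that the decision time is `m` confines `|h|²` to a disc,
contains an annulus, or lies in a far Gaussian tail (`timeProb_decay`). For the `m`-switch channel,
a primal solution of the linear program gives a box inside the outage event, and a dual solution
gives the exponent of a Chernoff bound (`switchOutageProb_decayLE`, `switchOutageProb_decayGE`).
Independence of `h` and `(g₁, g₂)`, with a union over `m`, then yields `outageProb_decay`. -/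

/-- Densities and coordinatewise maps commute with finite products of probability measures. -/
lemma pi_withDensity_map {ι : Type*} [Fintype ι] {α β : ι → Type*}
    [∀ i, MeasurableSpace (α i)] [∀ i, MeasurableSpace (β i)]
    (μ : ∀ i, Measure (α i)) [∀ i, IsProbabilityMeasure (μ i)]
    (ν : ∀ i, Measure (β i)) [∀ i, IsProbabilityMeasure (ν i)]
    {f : ∀ i, α i → ℝ≥0∞} {g : ∀ i, α i → β i}
    (hf : ∀ i, Measurable (f i)) (hg : ∀ i, Measurable (g i))
    (h : ∀ i, ((μ i).withDensity (f i)).map (g i) = ν i) :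
    ((Measure.pi μ).withDensity (fun x => ∏ i, f i (x i))).map (fun x i => g i (x i)) =
      Measure.pi ν := by
  symm
  refine Measure.pi_eq fun s hs => ?_
  have hgm : Measurable fun (x : ∀ i, α i) i => g i (x i) :=
    measurable_pi_lambda _ fun i => (hg i).comp (measurable_pi_apply i)
  have hm : ∀ i, MeasurableSet (g i ⁻¹' s i) := fun i => hg i (hs i)
  have hpre : (fun (x : ∀ i, α i) i => g i (x i)) ⁻¹' (Set.univ.pi s) =
      Set.univ.pi fun i => g i ⁻¹' s i := by
    ext x; simp
  rw [Measure.map_apply hgm (MeasurableSet.univ_pi hs), hpre,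
    withDensity_apply _ (MeasurableSet.univ_pi hm), ← lintegral_indicator (MeasurableSet.univ_pi hm)]
  have hind : ∀ x : ∀ i, α i,
      (Set.univ.pi fun i => g i ⁻¹' s i).indicator (fun x => ∏ i, f i (x i)) x =
        ∏ i, (g i ⁻¹' s i).indicator (f i) (x i) := by
    intro x
    by_cases hx : x ∈ Set.univ.pi fun i => g i ⁻¹' s i
    · rw [Set.indicator_of_mem hx]
      refine Finset.prod_congr rfl fun i _ => ?_
      rw [Set.indicator_of_mem (hx i (Set.mem_univ i))]
    · rw [Set.indicator_of_notMem hx]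
      simp only [Set.mem_univ_pi, not_forall] at hx
      obtain ⟨i, hi⟩ := hx
      exact (Finset.prod_eq_zero (Finset.mem_univ i) (Set.indicator_of_notMem hi _)).symm
  have hmi : ∀ i, Measurable ((g i ⁻¹' s i).indicator (f i)) := fun i => (hf i).indicator (hm i)
  simp_rw [hind]
  rw [lintegral_prod_eq_prod_lintegral_of_indepFun (μ := Measure.pi μ) Finset.univ
    (fun i x => (g i ⁻¹' s i).indicator (f i) (x i))
    (iIndepFun_pi fun i => (hmi i).aemeasurable)
    (fun i => (hmi i).comp (measurable_pi_apply i))]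
  refine Finset.prod_congr rfl fun i _ => ?_
  rw [(measurePreserving_eval μ i).lintegral_comp (hmi i), lintegral_indicator (hm i),
    ← withDensity_apply _ (hm i), ← Measure.map_apply (hg i) (hs i), h i]

/-! ### The complex Gaussian law: density, discs, annuli, tails, shifts, second moments. -/

instance (s : ℝ≥0) : IsProbabilityMeasure (complexNormal s) :=
  Measure.isProbabilityMeasure_map
    (Complex.measurableEquivRealProd.symm.measurable.aemeasurable)

instance (M T : ℕ) (s : ℝ≥0) : IsProbabilityMeasure (noiseLaw M T s) := by
  unfold noiseLaw; infer_instance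

/-- The density of `CN(0, s)`. -/
def normalDensity (s : ℝ) (z : ℂ) : ℝ := (Real.pi * s)⁻¹ * Real.exp (-‖z‖ ^ 2 / s)

lemma normalDensity_pos {s : ℝ} (hs : 0 < s) (z : ℂ) : 0 < normalDensity s z := by
  unfold normalDensity; positivity

@[fun_prop]
lemma measurable_normalDensity (s : ℝ) : Measurable (normalDensity s) := by
  unfold normalDensity; fun_prop

lemma complexNormal_eq_withDensity {s : ℝ≥0} (hs : 0 < s) :
    complexNormal s = volume.withDensity fun z => ENNReal.ofReal (normalDensity s z) := by
  have hs' : (0 : ℝ) < s := hs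
  have h2 : s / 2 ≠ 0 := by positivity
  have hpd : ∀ p : ℝ × ℝ, gaussianPDF 0 (s / 2) p.1 * gaussianPDF 0 (s / 2) p.2 =
      ENNReal.ofReal (normalDensity s (Complex.measurableEquivRealProd.symm p)) := by
    intro p
    rw [gaussianPDF, gaussianPDF, ← ENNReal.ofReal_mul (gaussianPDFReal_nonneg _ _ _)]
    congr 1
    have hn : ‖Complex.measurableEquivRealProd.symm p‖ ^ 2 = p.1 ^ 2 + p.2 ^ 2 := by
      rw [Complex.sq_norm, Complex.normSq_apply]
      simp [Complex.measurableEquivRealProd, sq]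
    have hv : (2 : ℝ) * ((s / 2 : ℝ≥0) : ℝ) = s := by push_cast; ring
    rw [gaussianPDFReal, gaussianPDFReal, normalDensity, hn, mul_mul_mul_comm, ← Real.exp_add,
      ← mul_inv, Real.mul_self_sqrt (by positivity), mul_right_comm, hv]
    congr 2
    · ring
    · ring
  have hmp := Complex.volume_preserving_equiv_real_prod.symm
  rw [complexNormal, gaussianReal_of_var_ne_zero _ h2,
    prod_withDensity (measurable_gaussianPDF _ _) (measurable_gaussianPDF _ _), funext hpd]
  change Measure.map Complex.measurableEquivRealProd.symm _ = _
  ext A hA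
  have hD : Measurable fun z => ENNReal.ofReal (normalDensity s z) := by fun_prop
  rw [Measure.map_apply Complex.measurableEquivRealProd.symm.measurable hA, withDensity_apply _ hA,
    withDensity_apply _ (Complex.measurableEquivRealProd.symm.measurable hA),
    ← hmp.setLIntegral_comp_preimage hA hD]
  rfl

lemma complexNormal_apply {s : ℝ≥0} (hs : 0 < s) {A : Set ℂ} (hA : MeasurableSet A) :
    complexNormal s A = ∫⁻ z in A, ENNReal.ofReal (normalDensity s z) := by
  rw [complexNormal_eq_withDensity hs, withDensity_apply _ hA]

lemma volume_sq_norm_le {t : ℝ} (ht : 0 ≤ t) :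
    volume {z : ℂ | ‖z‖ ^ 2 ≤ t} = ENNReal.ofReal (Real.pi * t) := by
  have : {z : ℂ | ‖z‖ ^ 2 ≤ t} = Metric.closedBall 0 (√t) := by
    ext z
    simp [Real.le_sqrt (norm_nonneg z) ht]
  rw [this, Complex.volume_closedBall, ← ENNReal.ofReal_pow (Real.sqrt_nonneg t),
    Real.sq_sqrt ht, mul_comm Real.pi, ENNReal.ofReal_mul ht]
  congr 1
  exact (ENNReal.ofReal_coe_nnreal (p := NNReal.pi)).symm

lemma measurableSet_sq_norm_le (t : ℝ) : MeasurableSet {z : ℂ | ‖z‖ ^ 2 ≤ t} :=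
  measurableSet_le (by fun_prop) (by fun_prop)

lemma complexNormal_sq_norm_le {t : ℝ} (ht : 0 ≤ t) :
    complexNormal 1 {z | ‖z‖ ^ 2 ≤ t} ≤ ENNReal.ofReal t := by
  rw [complexNormal_apply one_pos (measurableSet_sq_norm_le t)]
  calc _ ≤ ∫⁻ _ in {z : ℂ | ‖z‖ ^ 2 ≤ t}, ENNReal.ofReal Real.pi⁻¹ := by
        refine lintegral_mono fun z => ENNReal.ofReal_le_ofReal ?_
        rw [normalDensity, NNReal.coe_one, mul_one, div_one]
        refine mul_le_of_le_one_right (by positivity) (Real.exp_le_one_iff.2 ?_)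
        exact neg_nonpos.2 (sq_nonneg _)
    _ = ENNReal.ofReal t := by
        rw [setLIntegral_const, volume_sq_norm_le ht, ← ENNReal.ofReal_mul (by positivity)]
        congr 1
        field_simp

/-- The density is at least `π⁻¹ exp (-b)` on the annulus, whose area is `π (b - a)`. Annuli are
needed because fixing the decision time bounds `|h|²` on both sides. -/
lemma le_complexNormal_annulus {a b : ℝ} (ha : 0 ≤ a) (hab : a ≤ b) :
    ENNReal.ofReal (Real.exp (-b) * (b - a)) ≤
      complexNormal 1 {z | a < ‖z‖ ^ 2 ∧ ‖z‖ ^ 2 ≤ b} := by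
  have hset : {z : ℂ | a < ‖z‖ ^ 2 ∧ ‖z‖ ^ 2 ≤ b} =
      {z : ℂ | ‖z‖ ^ 2 ≤ b} \ {z : ℂ | ‖z‖ ^ 2 ≤ a} := by
    ext z; simp [and_comm]
  have hm : MeasurableSet {z : ℂ | a < ‖z‖ ^ 2 ∧ ‖z‖ ^ 2 ≤ b} := by
    rw [hset]
    exact (measurableSet_sq_norm_le b).diff (measurableSet_sq_norm_le a)
  have hvol : volume {z : ℂ | a < ‖z‖ ^ 2 ∧ ‖z‖ ^ 2 ≤ b} = ENNReal.ofReal (Real.pi * (b - a)) := by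
    have hsub : {z : ℂ | ‖z‖ ^ 2 ≤ a} ⊆ {z : ℂ | ‖z‖ ^ 2 ≤ b} := fun z hz => le_trans hz hab
    rw [hset, measure_sdiff hsub
      (measurableSet_sq_norm_le a).nullMeasurableSet, volume_sq_norm_le ha,
      volume_sq_norm_le (ha.trans hab), ← ENNReal.ofReal_sub _ (by positivity), mul_sub]
    rw [volume_sq_norm_le ha]
    exact ENNReal.ofReal_ne_top
  rw [complexNormal_apply one_pos hm]
  calc _ = ∫⁻ _ in {z : ℂ | a < ‖z‖ ^ 2 ∧ ‖z‖ ^ 2 ≤ b},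
        ENNReal.ofReal (Real.pi⁻¹ * Real.exp (-b)) := by
        rw [setLIntegral_const, hvol, ← ENNReal.ofReal_mul (by positivity)]
        congr 1
        field_simp
    _ ≤ _ := by
        refine setLIntegral_mono (by fun_prop) fun z hz => ENNReal.ofReal_le_ofReal ?_
        rw [normalDensity, NNReal.coe_one, mul_one, div_one]
        gcongr
        exact hz.2

lemma le_complexNormal_sq_norm_le {b : ℝ} (hb : 0 ≤ b) :
    ENNReal.ofReal (Real.exp (-b) * b) ≤ complexNormal 1 {z | ‖z‖ ^ 2 ≤ b} := by
  have := le_complexNormal_annulus le_rfl hb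
  rw [sub_zero] at this
  exact this.trans (measure_mono fun z hz => hz.2)

lemma complexNormal_lt_sq_norm (a : ℝ) :
    complexNormal 1 {z | a < ‖z‖ ^ 2} ≤ ENNReal.ofReal (2 * Real.exp (-a / 2)) := by
  have hm : MeasurableSet {z : ℂ | a < ‖z‖ ^ 2} := measurableSet_lt (by fun_prop) (by fun_prop)
  rw [complexNormal_apply one_pos hm]
  -- Half of the exponent pays for `exp (-a / 2)`; the other half, normalised by the factor 2, is
  -- the density of `CN(0, 2)`, of mass at most one. The exact tail `exp (-a)` is not needed.
  calc _ ≤ ∫⁻ z in {z : ℂ | a < ‖z‖ ^ 2},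
        ENNReal.ofReal (2 * Real.exp (-a / 2)) * ENNReal.ofReal (normalDensity (2 : ℝ≥0) z) := by
        refine setLIntegral_mono (by fun_prop) fun z hz => ?_
        rw [← ENNReal.ofReal_mul (by positivity)]
        refine ENNReal.ofReal_le_ofReal ?_
        have hz' : a < ‖z‖ ^ 2 := hz
        have h1 : Real.exp (-‖z‖ ^ 2) ≤ Real.exp (-a / 2) * Real.exp (-‖z‖ ^ 2 / 2) := by
          rw [← Real.exp_add]
          exact Real.exp_le_exp.2 (by linarith)
        rw [normalDensity, normalDensity, NNReal.coe_one, mul_one, div_one]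
        calc Real.pi⁻¹ * Real.exp (-‖z‖ ^ 2)
            ≤ Real.pi⁻¹ * (Real.exp (-a / 2) * Real.exp (-‖z‖ ^ 2 / 2)) := by gcongr
          _ = _ := by push_cast; field_simp
    _ = ENNReal.ofReal (2 * Real.exp (-a / 2)) * complexNormal 2 {z | a < ‖z‖ ^ 2} := by
        rw [lintegral_const_mul _ (by fun_prop), complexNormal_apply two_pos hm]
    _ ≤ _ := mul_le_of_le_one_right' prob_le_one

/-- Change of measure between shifted Gaussians. -/
lemma complexNormal_shift {σ τ : ℝ≥0} (hσ : 0 < σ) (hτ : 0 < τ) (c : ℂ) :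
    ((complexNormal σ).withDensity fun w =>
      ENNReal.ofReal (normalDensity τ (c + w) / normalDensity σ w)).map (fun w => c + w) =
      complexNormal τ := by
  have hm1 : Measurable fun w => ENNReal.ofReal (normalDensity τ (c + w) / normalDensity σ w) := by
    have : Measurable fun w => normalDensity τ (c + w) :=
      (measurable_normalDensity τ).comp (measurable_const_add c)
    fun_prop
  have hm2 : Measurable fun z => ENNReal.ofReal (normalDensity τ z) := by fun_prop
  rw [complexNormal_eq_withDensity hσ, ← withDensity_mul _ (by fun_prop) hm1,
    complexNormal_eq_withDensity hτ]
  have : ((fun z => ENNReal.ofReal (normalDensity σ z)) *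
      fun w => ENNReal.ofReal (normalDensity τ (c + w) / normalDensity σ w)) =
      fun w => ENNReal.ofReal (normalDensity τ (c + w)) := by
    ext w
    have h := normalDensity_pos (s := σ) hσ w
    rw [Pi.mul_apply, ← ENNReal.ofReal_mul h.le, mul_div_cancel₀ _ h.ne']
  rw [this]
  ext A hA
  rw [Measure.map_apply (measurable_const_add c) hA, withDensity_apply _ hA,
    withDensity_apply _ (measurable_const_add c hA)]
  exact (measurePreserving_add_left volume c).setLIntegral_comp_preimage hA hm2

lemma integrable_sq_add_gaussianReal (v : ℝ≥0) (a : ℝ) :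
    Integrable (fun x => (a + x) ^ 2) (gaussianReal 0 v) :=
  ((memLp_const a).add (memLp_id_gaussianReal' 2 (by simp))).integrable_sq

lemma integral_sq_add_gaussianReal (v : ℝ≥0) (a : ℝ) :
    ∫ x, (a + x) ^ 2 ∂(gaussianReal 0 v) = a ^ 2 + v := by
  have hL : MemLp (fun x : ℝ => a + x) 2 (gaussianReal 0 v) :=
    (memLp_const a).add (memLp_id_gaussianReal' 2 (by simp))
  have hI : Integrable (fun x : ℝ => x) (gaussianReal 0 v) :=
    (memLp_id_gaussianReal' (μ := 0) (v := v) 1 (by simp)).integrable le_rfl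
  have hmean : ∫ x, (a + x) ∂(gaussianReal 0 v) = a := by
    rw [integral_add (integrable_const a) hI, integral_id_gaussianReal]
    simp
  have hvar := variance_eq_sub hL
  rw [variance_const_add hI.aestronglyMeasurable, variance_fun_id_gaussianReal] at hvar
  simp only [Pi.pow_apply, hmean] at hvar
  linarith

lemma integrable_sq_norm_add (s : ℝ≥0) (c : ℂ) :
    Integrable (fun w => ‖c + w‖ ^ 2) (complexNormal s) := by
  change Integrable _ (Measure.map Complex.measurableEquivRealProd.symm _)
  rw [Complex.measurableEquivRealProd.symm.measurableEmbedding.integrable_map_iff]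
  have : ((fun w => ‖c + w‖ ^ 2) ∘ Complex.measurableEquivRealProd.symm) =
      fun p : ℝ × ℝ => (c.re + p.1) ^ 2 + (c.im + p.2) ^ 2 := by
    ext p
    rw [Function.comp_apply, Complex.sq_norm, Complex.normSq_apply]
    simp [Complex.measurableEquivRealProd, sq]
  rw [this]
  exact ((integrable_sq_add_gaussianReal _ _).comp_fst _).add
    ((integrable_sq_add_gaussianReal _ _).comp_snd _)

lemma integral_sq_norm_add (s : ℝ≥0) (c : ℂ) :
    ∫ w, ‖c + w‖ ^ 2 ∂(complexNormal s) = ‖c‖ ^ 2 + s := by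
  change ∫ w, _ ∂(Measure.map Complex.measurableEquivRealProd.symm _) = _
  rw [integral_map_equiv]
  have : ∀ p, ‖c + Complex.measurableEquivRealProd.symm p‖ ^ 2 =
      (c.re + p.1) ^ 2 + (c.im + p.2) ^ 2 := by
    intro p
    rw [Complex.sq_norm, Complex.normSq_apply]
    simp [Complex.measurableEquivRealProd, sq]
  simp_rw [this]
  rw [integral_add ((integrable_sq_add_gaussianReal _ _).comp_fst _)
    ((integrable_sq_add_gaussianReal _ _).comp_snd _),
    integral_fun_fst (fun x => (c.re + x) ^ 2), integral_fun_snd (fun x => (c.im + x) ^ 2),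
    integral_sq_add_gaussianReal, integral_sq_add_gaussianReal, Complex.sq_norm,
    Complex.normSq_apply]
  simp only [probReal_univ, one_smul]
  push_cast
  ring

/-! ### Likelihood ratios and Gibbs' inequality for a signal in white Gaussian noise. -/

/-- The product of the laws `CN(0, τ i)`, for the symbols of slot `i`. -/
def blockLaw (M T : ℕ) (τ : Fin M → ℝ≥0) : Measure (Block M T) :=
  Measure.pi fun i => Measure.pi fun _ : Fin T => complexNormal (τ i)

instance (M T : ℕ) (τ : Fin M → ℝ≥0) : IsProbabilityMeasure (blockLaw M T τ) := by
  unfold blockLaw; infer_instance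

/-- The likelihood ratio, at the noise `w`, of `blockLaw M T τ` against white noise of variance
`σ` shifted by `c`. -/
def shiftRatio {M T : ℕ} (σ : ℝ≥0) (τ : Fin M → ℝ≥0) (c w : Block M T) : ℝ :=
  ∏ i, ∏ t, normalDensity (τ i) (c i t + w i t) / normalDensity σ (w i t)

section

variable {M T : ℕ} {σ : ℝ≥0} {τ : Fin M → ℝ≥0}

lemma shiftRatio_pos (hσ : 0 < σ) (hτ : ∀ i, 0 < τ i) (c w : Block M T) :
    0 < shiftRatio σ τ c w :=
  Finset.prod_pos fun i _ => Finset.prod_pos fun _ _ =>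
    div_pos (normalDensity_pos (NNReal.coe_pos.2 (hτ i)) _) (normalDensity_pos (NNReal.coe_pos.2 hσ) _)

lemma measurable_shiftRatio :
    Measurable fun p : Block M T × Block M T => shiftRatio σ τ p.1 p.2 := by
  unfold shiftRatio
  refine Finset.measurable_fun_prod _ fun i _ => Finset.measurable_fun_prod _ fun t _ => ?_
  refine Measurable.div ((measurable_normalDensity _).comp ?_)
    ((measurable_normalDensity _).comp ?_) <;> fun_prop

lemma measurable_normalDensity_ratio (σ τ : ℝ) (c : ℂ) :
    Measurable fun w : ℂ => ENNReal.ofReal (normalDensity τ (c + w) / normalDensity σ w) := by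
  have : Measurable fun w => normalDensity τ (c + w) :=
    (measurable_normalDensity τ).comp (measurable_const_add c)
  fun_prop

lemma slotLaw_shift {υ : ℝ≥0} (hσ : 0 < σ) (hυ : 0 < υ) (c : Fin T → ℂ) :
    ((Measure.pi fun _ : Fin T => complexNormal σ).withDensity fun w =>
      ∏ t, ENNReal.ofReal (normalDensity υ (c t + w t) / normalDensity σ (w t))).map
        (fun w t => c t + w t) = Measure.pi fun _ : Fin T => complexNormal υ :=
  pi_withDensity_map (α := fun _ : Fin T => ℂ) (β := fun _ : Fin T => ℂ)
    (fun _ : Fin T => complexNormal σ) (fun _ : Fin T => complexNormal υ)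
    (f := fun t w => ENNReal.ofReal (normalDensity υ (c t + w) / normalDensity σ w))
    (g := fun t w => c t + w)
    (fun _ => measurable_normalDensity_ratio _ _ _) (fun _ => measurable_const_add _)
    fun t => complexNormal_shift hσ hυ (c t)

lemma ofReal_shiftRatio (hσ : 0 < σ) (hτ : ∀ i, 0 < τ i) (c w : Block M T) :
    ENNReal.ofReal (shiftRatio σ τ c w) = ∏ i, ∏ t,
      ENNReal.ofReal (normalDensity (τ i) (c i t + w i t) / normalDensity σ (w i t)) := by
  have h0 : ∀ i t, 0 ≤ normalDensity (τ i) (c i t + w i t) / normalDensity σ (w i t) :=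
    fun i t => (div_pos (normalDensity_pos (NNReal.coe_pos.2 (hτ i)) _)
      (normalDensity_pos (NNReal.coe_pos.2 hσ) _)).le
  rw [shiftRatio, ENNReal.ofReal_prod_of_nonneg fun i _ => Finset.prod_nonneg fun t _ => h0 i t]
  exact Finset.prod_congr rfl fun i _ => ENNReal.ofReal_prod_of_nonneg fun t _ => h0 i t

lemma noiseLaw_shift (hσ : 0 < σ) (hτ : ∀ i, 0 < τ i) (c : Block M T) :
    ((noiseLaw M T σ).withDensity fun w => ENNReal.ofReal (shiftRatio σ τ c w)).map
      (fun w => c + w) = blockLaw M T τ := by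
  have h := pi_withDensity_map (α := fun _ : Fin M => Fin T → ℂ) (β := fun _ : Fin M => Fin T → ℂ)
    (fun _ : Fin M => Measure.pi fun _ : Fin T => complexNormal σ)
    (fun i => Measure.pi fun _ : Fin T => complexNormal (τ i))
    (f := fun i w => ∏ t, ENNReal.ofReal
      (normalDensity (τ i) (c i t + w t) / normalDensity σ (w t)))
    (g := fun i w t => c i t + w t)
    (fun i => Finset.measurable_fun_prod _ fun t _ =>
      (measurable_normalDensity_ratio _ _ _).comp (measurable_pi_apply t))
    (fun i => measurable_pi_lambda _ fun t => (measurable_pi_apply t).const_add _)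
    (fun i => slotLaw_shift hσ (hτ i) (c i))
  simp_rw [ofReal_shiftRatio hσ hτ c]
  exact h

lemma lintegral_shiftRatio_mul (hσ : 0 < σ) (hτ : ∀ i, 0 < τ i) (c : Block M T)
    {F : Block M T → ℝ≥0∞} (hF : Measurable F) :
    ∫⁻ w, ENNReal.ofReal (shiftRatio σ τ c w) * F (c + w) ∂(noiseLaw M T σ) =
      ∫⁻ y, F y ∂(blockLaw M T τ) := by
  have hm : Measurable fun w => ENNReal.ofReal (shiftRatio σ τ c w) :=
    (measurable_shiftRatio.comp measurable_prodMk_left).ennreal_ofReal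
  rw [← noiseLaw_shift hσ hτ c, lintegral_map hF (measurable_const_add c)]
  exact (lintegral_withDensity_eq_lintegral_mul _ hm (hF.comp (measurable_const_add c))).symm

lemma log_shiftRatio (hσ : 0 < σ) (hτ : ∀ i, 0 < τ i) (c w : Block M T) :
    Real.log (shiftRatio σ τ c w) =
      ∑ i, ∑ t, (Real.log (σ / τ i) + ‖w i t‖ ^ 2 / σ - ‖c i t + w i t‖ ^ 2 / τ i) := by
  have hσ' : (0 : ℝ) < σ := hσ
  have h0 : ∀ i t, 0 < normalDensity (τ i) (c i t + w i t) / normalDensity σ (w i t) := fun i t =>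
    div_pos (normalDensity_pos (NNReal.coe_pos.2 (hτ i)) _) (normalDensity_pos (NNReal.coe_pos.2 hσ) _)
  rw [shiftRatio, Real.log_prod fun i _ => (Finset.prod_pos fun t _ => h0 i t).ne']
  refine Finset.sum_congr rfl fun i _ => ?_
  rw [Real.log_prod fun t _ => (h0 i t).ne']
  refine Finset.sum_congr rfl fun t _ => ?_
  have hτ' : (0 : ℝ) < τ i := hτ i
  rw [normalDensity, normalDensity, Real.log_div (by positivity) (by positivity),
    Real.log_mul (by positivity) (Real.exp_pos _).ne', Real.log_mul (by positivity)
    (Real.exp_pos _).ne', Real.log_exp, Real.log_exp, Real.log_inv, Real.log_inv,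
    Real.log_mul Real.pi_ne_zero hσ'.ne', Real.log_mul Real.pi_ne_zero hτ'.ne',
    Real.log_div hσ'.ne' hτ'.ne']
  ring

lemma noiseLaw_map_apply (i : Fin M) (t : Fin T) :
    MeasurePreserving (fun w : Block M T => w i t) (noiseLaw M T σ) (complexNormal σ) :=
  (measurePreserving_eval (fun _ : Fin T => complexNormal σ) t).comp
    (measurePreserving_eval (fun _ : Fin M => Measure.pi fun _ : Fin T => complexNormal σ) i)

lemma integrable_sq_norm_add_noise (c : ℂ) (i : Fin M) (t : Fin T) :
    Integrable (fun w : Block M T => ‖c + w i t‖ ^ 2) (noiseLaw M T σ) :=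
  (noiseLaw_map_apply i t).integrable_comp_of_integrable (integrable_sq_norm_add σ c)

lemma integral_sq_norm_add_noise (c : ℂ) (i : Fin M) (t : Fin T) :
    ∫ w : Block M T, ‖c + w i t‖ ^ 2 ∂(noiseLaw M T σ) = ‖c‖ ^ 2 + (σ : ℝ) := by
  rw [← integral_sq_norm_add σ c, ← (noiseLaw_map_apply (σ := σ) i t).map_eq, integral_map
    (noiseLaw_map_apply (σ := σ) i t).measurable.aemeasurable]
  exact (by fun_prop : Measurable fun w : ℂ => ‖c + w‖ ^ 2).aestronglyMeasurable

variable {V : Type*} [MeasurableSpace V] {ν : Measure V} [IsProbabilityMeasure ν]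
  {s : V → Block M T}

lemma integrable_sq_norm_signal_add (hs : Measurable s)
    (hint : ∀ i t, Integrable (fun v => ‖s v i t‖ ^ 2) ν) (i : Fin M) (t : Fin T) :
    Integrable (fun p : V × Block M T => ‖s p.1 i t + p.2 i t‖ ^ 2)
      (ν.prod (noiseLaw M T σ)) := by
  have hm1 : Measurable fun p : V × Block M T => s p.1 i t :=
    (measurable_pi_apply t).comp ((measurable_pi_apply i).comp (hs.comp measurable_fst))
  have hm2 : Measurable fun p : V × Block M T => p.2 i t := by fun_prop
  refine Integrable.mono' (g := fun p => 2 * ‖s p.1 i t‖ ^ 2 + 2 * ‖0 + p.2 i t‖ ^ 2)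
    ((((hint i t).comp_fst _).const_mul 2).add
      (((integrable_sq_norm_add_noise 0 i t).comp_snd _).const_mul 2))
    ((hm1.add hm2).norm.pow_const 2).aestronglyMeasurable (ae_of_all _ fun p => ?_)
  rw [Real.norm_of_nonneg (sq_nonneg _), zero_add]
  have := norm_add_le (s p.1 i t) (p.2 i t)
  have h0 := norm_nonneg (s p.1 i t + p.2 i t)
  nlinarith [sq_nonneg (‖s p.1 i t‖ - ‖p.2 i t‖)]

lemma integral_sq_norm_signal_add (hs : Measurable s)
    (hint : ∀ i t, Integrable (fun v => ‖s v i t‖ ^ 2) ν) (i : Fin M) (t : Fin T) :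
    ∫ p : V × Block M T, ‖s p.1 i t + p.2 i t‖ ^ 2 ∂(ν.prod (noiseLaw M T σ)) =
      ∫ v, ‖s v i t‖ ^ 2 ∂ν + σ := by
  rw [integral_prod _ (integrable_sq_norm_signal_add hs hint i t)]
  simp_rw [integral_sq_norm_add_noise]
  rw [integral_add (hint i t) (integrable_const _)]
  simp

lemma integrable_log_shiftRatio (hσ : 0 < σ) (hτ : ∀ i, 0 < τ i) (hs : Measurable s)
    (hint : ∀ i t, Integrable (fun v => ‖s v i t‖ ^ 2) ν) :
    Integrable (fun p : V × Block M T => Real.log (shiftRatio σ τ (s p.1) p.2))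
      (ν.prod (noiseLaw M T σ)) := by
  simp_rw [log_shiftRatio hσ hτ]
  refine integrable_finsetSum _ fun i _ => integrable_finsetSum _ fun t _ => ?_
  refine Integrable.sub ((integrable_const _).add ?_)
    ((integrable_sq_norm_signal_add hs hint i t).div_const _)
  have := ((integrable_sq_norm_add_noise (σ := σ) 0 i t).comp_snd ν).div_const (σ : ℝ)
  simpa using this

/-- Only the second moments of the signal enter. This is why average power constraints suffice for
the converse, with no assumption on the shape of the codes. -/
lemma integral_log_shiftRatio (hσ : 0 < σ) (hτ : ∀ i, 0 < τ i) (hs : Measurable s)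
    (hint : ∀ i t, Integrable (fun v => ‖s v i t‖ ^ 2) ν) :
    ∫ p : V × Block M T, Real.log (shiftRatio σ τ (s p.1) p.2) ∂(ν.prod (noiseLaw M T σ)) =
      ∑ i, ∑ t, (Real.log (σ / τ i) + 1 - (∫ v, ‖s v i t‖ ^ 2 ∂ν + σ) / τ i) := by
  have hσ' : (0 : ℝ) < σ := hσ
  have h2 : ∀ i t, Integrable (fun p : V × Block M T => ‖p.2 i t‖ ^ 2 / σ)
      (ν.prod (noiseLaw M T σ)) := fun i t => by
    have := ((integrable_sq_norm_add_noise (σ := σ) 0 i t).comp_snd ν).div_const (σ : ℝ)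
    simpa using this
  have h1 : ∀ i t, Integrable (fun p : V × Block M T =>
      Real.log (σ / τ i) + ‖p.2 i t‖ ^ 2 / σ) (ν.prod (noiseLaw M T σ)) := fun i t =>
    (integrable_const _).add (h2 i t)
  have h3 : ∀ i t, Integrable (fun p : V × Block M T => ‖s p.1 i t + p.2 i t‖ ^ 2 / τ i)
      (ν.prod (noiseLaw M T σ)) := fun i t =>
    (integrable_sq_norm_signal_add hs hint i t).div_const _
  have h4 : ∀ i t, Integrable (fun p : V × Block M T => Real.log (σ / τ i) + ‖p.2 i t‖ ^ 2 / σ -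
      ‖s p.1 i t + p.2 i t‖ ^ 2 / τ i) (ν.prod (noiseLaw M T σ)) := fun i t => (h1 i t).sub (h3 i t)
  simp_rw [log_shiftRatio hσ hτ]
  rw [integral_finsetSum _ fun i _ => integrable_finsetSum _ fun t _ => h4 i t]
  refine Finset.sum_congr rfl fun i _ => ?_
  rw [integral_finsetSum _ fun t _ => h4 i t]
  refine Finset.sum_congr rfl fun t _ => ?_
  rw [integral_sub (h1 i t) (h3 i t), integral_add (integrable_const _) (h2 i t),
    integral_div, integral_div, integral_sq_norm_signal_add hs hint]
  have : ∫ p : V × Block M T, ‖p.2 i t‖ ^ 2 ∂(ν.prod (noiseLaw M T σ)) = σ := by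
    rw [integral_fun_snd (fun w : Block M T => ‖w i t‖ ^ 2)]
    have := integral_sq_norm_add_noise (σ := σ) 0 i t
    simpa using this
  rw [this, div_self hσ'.ne']
  simp

/-- For each fixed `v` the reweighted output has law `blockLaw M T τ`, whatever the signal, so the
average over `v` disappears. -/
lemma lintegral_signal_shiftRatio_mul (hσ : 0 < σ) (hτ : ∀ i, 0 < τ i) (hs : Measurable s)
    {F : Block M T → ℝ} (hF : Measurable F) :
    ∫⁻ p : V × Block M T, ENNReal.ofReal (shiftRatio σ τ (s p.1) p.2 * F (s p.1 + p.2))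
      ∂(ν.prod (noiseLaw M T σ)) = ∫⁻ y, ENNReal.ofReal (F y) ∂(blockLaw M T τ) := by
  have hm : Measurable fun p : V × Block M T =>
      shiftRatio σ τ (s p.1) p.2 * F (s p.1 + p.2) :=
    (measurable_shiftRatio.comp ((hs.comp measurable_fst).prodMk measurable_snd)).mul
      (hF.comp ((hs.comp measurable_fst).add measurable_snd))
  rw [lintegral_prod _ hm.ennreal_ofReal.aemeasurable]
  have : ∀ v, ∫⁻ w, ENNReal.ofReal (shiftRatio σ τ (s v) w * F (s v + w)) ∂(noiseLaw M T σ) =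
      ∫⁻ y, ENNReal.ofReal (F y) ∂(blockLaw M T τ) := fun v => by
    rw [← lintegral_shiftRatio_mul hσ hτ (s v) hF.ennreal_ofReal]
    exact lintegral_congr fun w => ENNReal.ofReal_mul (shiftRatio_pos hσ hτ _ _).le
  rw [lintegral_congr this, lintegral_const, measure_univ, mul_one]

lemma integral_signal_shiftRatio_mul (hσ : 0 < σ) (hτ : ∀ i, 0 < τ i) (hs : Measurable s)
    {F : Block M T → ℝ} (hF : Measurable F) (hF0 : ∀ y, 0 ≤ F y)
    (hFi : Integrable F (blockLaw M T τ)) :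
    Integrable (fun p : V × Block M T => shiftRatio σ τ (s p.1) p.2 * F (s p.1 + p.2))
      (ν.prod (noiseLaw M T σ)) ∧
    ∫ p : V × Block M T, shiftRatio σ τ (s p.1) p.2 * F (s p.1 + p.2)
      ∂(ν.prod (noiseLaw M T σ)) = ∫ y, F y ∂(blockLaw M T τ) := by
  have hm : Measurable fun p : V × Block M T =>
      shiftRatio σ τ (s p.1) p.2 * F (s p.1 + p.2) :=
    (measurable_shiftRatio.comp ((hs.comp measurable_fst).prodMk measurable_snd)).mul
      (hF.comp ((hs.comp measurable_fst).add measurable_snd))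
  have h0 : ∀ p : V × Block M T, 0 ≤ shiftRatio σ τ (s p.1) p.2 * F (s p.1 + p.2) := fun p =>
    mul_nonneg (shiftRatio_pos hσ hτ _ _).le (hF0 _)
  constructor
  · refine ⟨hm.aestronglyMeasurable, ?_⟩
    rw [hasFiniteIntegral_iff_ofReal (ae_of_all _ h0), lintegral_signal_shiftRatio_mul hσ hτ hs hF,
      ← ofReal_integral_eq_lintegral_ofReal hFi (ae_of_all _ hF0)]
    exact ENNReal.ofReal_lt_top
  · rw [integral_eq_lintegral_of_nonneg_ae (ae_of_all _ h0) hm.aestronglyMeasurable,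
      lintegral_signal_shiftRatio_mul hσ hτ hs hF,
      integral_eq_lintegral_of_nonneg_ae (ae_of_all _ hF0) hF.aestronglyMeasurable]

/-- This is `log t ≤ t - 1` at `t = Z exp x / B`. The free constant `B` will stand for a bound on
the mean of `Z F`; integrating then gives the variational inequality. -/
lemma gibbs_pointwise {Z x F B : ℝ} (hZ : 0 < Z) (hB : 0 < B) (hF : Real.exp x ≤ F) :
    x + Real.log Z ≤ Z * F / B + Real.log B - 1 := by
  have h1 := Real.log_le_sub_one_of_pos (show 0 < Z * Real.exp x / B by positivity)
  rw [Real.log_div (by positivity) hB.ne', Real.log_mul hZ.ne' (Real.exp_pos _).ne',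
    Real.log_exp] at h1
  have h2 : Z * Real.exp x / B ≤ Z * F / B := by gcongr
  linarith

/-- Gibbs' variational inequality for a signal in white Gaussian noise: it bounds the
probability that the output lies in `A` by the probability of `A` under a Gaussian law. -/
lemma gibbs_gaussian_channel (hσ : 0 < σ) (hτ : ∀ i, 0 < τ i) (hs : Measurable s)
    (hint : ∀ i t, Integrable (fun v => ‖s v i t‖ ^ 2) ν) {A : Set (Block M T)}
    (hA : MeasurableSet A) (l : ℝ) {B : ℝ} (hB : 0 < B) :
    l * (ν.prod (noiseLaw M T σ)).real {p | s p.1 + p.2 ∈ A} +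
      ∑ i, ∑ t, (Real.log (σ / τ i) + 1 - (∫ v, ‖s v i t‖ ^ 2 ∂ν + σ) / τ i) ≤
    (1 + Real.exp l * (blockLaw M T τ).real A) / B + Real.log B - 1 := by
  have hSm : MeasurableSet {p : V × Block M T | s p.1 + p.2 ∈ A} :=
    ((hs.comp measurable_fst).add measurable_snd) hA
  have hi1 : Integrable (A.indicator (fun _ => (1 : ℝ))) (blockLaw M T τ) :=
    (integrable_const (1 : ℝ)).indicator hA
  have hFi : Integrable (fun y => 1 + Real.exp l * A.indicator (fun _ => (1 : ℝ)) y)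
      (blockLaw M T τ) := (integrable_const _).add (hi1.const_mul _)
  have hFm : Measurable (fun y => 1 + Real.exp l * A.indicator (fun _ => (1 : ℝ)) y) :=
    ((measurable_const.indicator hA).const_mul _).const_add _
  obtain ⟨hGi, hGint⟩ := integral_signal_shiftRatio_mul (ν := ν) hσ hτ hs hFm (fun y =>
    add_nonneg zero_le_one (mul_nonneg (Real.exp_pos l).le
      (Set.indicator_nonneg (fun _ _ => zero_le_one) y))) hFi
  rw [integral_add (integrable_const _) (hi1.const_mul _), integral_const_mul,
    integral_indicator_const _ hA, integral_const, probReal_univ, one_smul, smul_eq_mul,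
    mul_one] at hGint
  have hlog := integrable_log_shiftRatio (ν := ν) hσ hτ hs hint
  have hind : Integrable ({p : V × Block M T | s p.1 + p.2 ∈ A}.indicator (fun _ => (1 : ℝ)))
      (ν.prod (noiseLaw M T σ)) := (integrable_const (1 : ℝ)).indicator hSm
  have hle : ∀ p : V × Block M T,
      l * {p : V × Block M T | s p.1 + p.2 ∈ A}.indicator (fun _ => (1 : ℝ)) p +
        Real.log (shiftRatio σ τ (s p.1) p.2) ≤
      shiftRatio σ τ (s p.1) p.2 *
        (1 + Real.exp l * A.indicator (fun _ => (1 : ℝ)) (s p.1 + p.2)) / B + Real.log B - 1 := by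
    intro p
    -- Applied with `x = l 1_A`, through `exp (l 1_A) ≤ 1 + exp l 1_A`, whose mean under the
    -- Gaussian law is explicit.
    refine gibbs_pointwise (shiftRatio_pos hσ hτ _ _) hB ?_
    by_cases hp : s p.1 + p.2 ∈ A
    · rw [Set.indicator_of_mem hp, Set.indicator_of_mem (show p ∈ {p | s p.1 + p.2 ∈ A} from hp)]
      simp
    · rw [Set.indicator_of_notMem hp,
        Set.indicator_of_notMem (show p ∉ {p | s p.1 + p.2 ∈ A} from hp)]
      simp
  have hr1 : Integrable (fun p : V × Block M T => shiftRatio σ τ (s p.1) p.2 *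
      (1 + Real.exp l * A.indicator (fun _ => (1 : ℝ)) (s p.1 + p.2)) / B)
      (ν.prod (noiseLaw M T σ)) := hGi.div_const B
  have hr2 : Integrable (fun p : V × Block M T => shiftRatio σ τ (s p.1) p.2 *
      (1 + Real.exp l * A.indicator (fun _ => (1 : ℝ)) (s p.1 + p.2)) / B + Real.log B)
      (ν.prod (noiseLaw M T σ)) := hr1.add (integrable_const _)
  have h := integral_mono ((hind.const_mul l).add hlog) (hr2.sub (integrable_const 1)) hle
  rw [integral_sub' hr2 (integrable_const 1), integral_add hr1 (integrable_const _),
    integral_div, hGint, integral_add' (hind.const_mul l) hlog, integral_const_mul,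
    integral_indicator_const _ hSm, integral_log_shiftRatio hσ hτ hs hint, integral_const,
    integral_const, probReal_univ, one_smul, one_smul, smul_eq_mul, mul_one] at h
  exact h

end

/-! ### Power and Fano's inequality for a scheme, given the gains. -/

/-- Converts the extended nonnegative power constraints to real integrals: finiteness of the average
forces integrability for every message. -/
lemma average_le_of_lintegral {V : Type*} [MeasurableSpace V] {ν : Measure V} {K : ℕ}
    (hK : K ≠ 0) {f : Fin K → V → ℝ} (hf : ∀ ω, Measurable (f ω)) (h0 : ∀ ω v, 0 ≤ f ω v) {E : ℝ}
    (hE : 0 ≤ E) (h : (K : ℝ≥0∞)⁻¹ * ∑ ω, ∫⁻ v, ENNReal.ofReal (f ω v) ∂ν ≤ ENNReal.ofReal E) :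
    (∀ ω, Integrable (f ω) ν) ∧ (K : ℝ)⁻¹ * ∑ ω, ∫ v, f ω v ∂ν ≤ E := by
  have hK0 : (K : ℝ≥0∞)⁻¹ ≠ 0 := ENNReal.inv_ne_zero.2 (ENNReal.natCast_ne_top K)
  have hsum : ∑ ω, ∫⁻ v, ENNReal.ofReal (f ω v) ∂ν ≠ ∞ := fun htop => by
    rw [htop, ENNReal.mul_top hK0] at h
    exact absurd h (not_le.2 ENNReal.ofReal_lt_top)
  have hint : ∀ ω, Integrable (f ω) ν := fun ω => by
    refine ⟨(hf ω).aestronglyMeasurable, ?_⟩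
    rw [hasFiniteIntegral_iff_ofReal (ae_of_all _ (h0 ω))]
    exact lt_of_le_of_lt (Finset.single_le_sum (f := fun ω => ∫⁻ v, ENNReal.ofReal (f ω v) ∂ν)
      (fun _ _ => zero_le) (Finset.mem_univ ω)) (lt_top_iff_ne_top.2 hsum)
  refine ⟨hint, ?_⟩
  have hpos : (0 : ℝ) < K := by positivity
  rw [Finset.sum_congr rfl fun ω _ =>
    (ofReal_integral_eq_lintegral_ofReal (hint ω) (ae_of_all _ (h0 ω))).symm,
    ← ENNReal.ofReal_sum_of_nonneg fun ω _ => integral_nonneg (h0 ω),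
    ← ENNReal.ofReal_natCast, ← ENNReal.ofReal_inv_of_pos hpos,
    ← ENNReal.ofReal_mul (by positivity)] at h
  exact (ENNReal.ofReal_le_ofReal_iff hE).1 h

lemma ofReal_sq_norm (z : ℂ) : ENNReal.ofReal (‖z‖ ^ 2) = ‖z‖ₑ ^ 2 := by
  rw [ENNReal.ofReal_pow (norm_nonneg z), ofReal_norm]

namespace Scheme

variable {M T : ℕ} {sw sv : ℝ≥0} {ρ : ℝ} (C : Scheme M T sw sv ρ)

lemma measurable_relayInput (ω : Fin C.K) :
    Measurable fun p : ℂ × Block M T => C.relayInput ω p.1 p.2 := by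
  unfold relayInput
  fun_prop

lemma measurable_decisionTime (ω : Fin C.K) :
    Measurable fun p : ℂ × Block M T => C.time p.1 (C.relayInput ω p.1 p.2) :=
  C.measurable_time.comp (measurable_fst.prodMk (C.measurable_relayInput ω))

lemma measurable_relayOutput (ω : Fin C.K) :
    Measurable fun p : ℂ × Block M T => C.relayOutput ω p.1 p.2 := by
  refine measurable_pi_lambda _ fun i => measurable_pi_lambda _ fun t => ?_
  refine Measurable.ite (measurableSet_le (C.measurable_decisionTime ω) measurable_const) ?_
    measurable_const
  exact (measurable_of_countable fun k => C.xr k i t).comp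
    (C.measurable_relayMsg.comp (measurable_fst.prodMk (C.measurable_relayInput ω)))

lemma measurable_destInput (ω : Fin C.K) :
    Measurable fun c : ℂ × ℂ × ℂ × Block M T × Block M T =>
      C.destInput ω c.1 c.2.1 c.2.2.1 c.2.2.2.1 c.2.2.2.2 := by
  have h : Measurable fun c : ℂ × ℂ × ℂ × Block M T × Block M T =>
      C.relayOutput ω c.1 c.2.2.2.1 :=
    (C.measurable_relayOutput ω).comp (f := fun c : ℂ × ℂ × ℂ × Block M T × Block M T =>
      (c.1, c.2.2.2.1)) (by fun_prop)
  refine measurable_pi_lambda _ fun i => measurable_pi_lambda _ fun t => ?_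
  have h' : Measurable fun c : ℂ × ℂ × ℂ × Block M T × Block M T =>
      C.relayOutput ω c.1 c.2.2.2.1 i t := by fun_prop
  unfold destInput
  fun_prop

lemma measurableSet_error (ω : Fin C.K) :
    MeasurableSet {c : ℂ × ℂ × ℂ × Block M T × Block M T |
      C.dest (C.time c.1 (C.relayInput ω c.1 c.2.2.2.1)) c.2.1 c.2.2.1
        (C.destInput ω c.1 c.2.1 c.2.2.1 c.2.2.2.1 c.2.2.2.2) ≠ ω} := by
  have h1 : Measurable fun c : ℂ × ℂ × ℂ × Block M T × Block M T =>
      C.time c.1 (C.relayInput ω c.1 c.2.2.2.1) :=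
    (C.measurable_decisionTime ω).comp (f := fun c : ℂ × ℂ × ℂ × Block M T × Block M T =>
      (c.1, c.2.2.2.1)) (by fun_prop)
  have h2 : Measurable fun q : ℕ × ℂ × ℂ × Block M T => C.dest q.1 q.2.1 q.2.2.1 q.2.2.2 :=
    measurable_from_prod_countable_right fun m => C.measurable_dest m
  have h3 : Measurable fun c : ℂ × ℂ × ℂ × Block M T × Block M T =>
      (C.time c.1 (C.relayInput ω c.1 c.2.2.2.1), c.2.1, c.2.2.1,
        C.destInput ω c.1 c.2.1 c.2.2.1 c.2.2.2.1 c.2.2.2.2) :=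
    h1.prodMk (measurable_snd.fst.prodMk
      (measurable_snd.snd.fst.prodMk (C.measurable_destInput ω)))
  exact (h2.comp h3) (measurableSet_singleton ω).compl

lemma K_ne_zero : C.K ≠ 0 := by have := C.two_le_K; omega

/-- The average power of the signal part of what the destination receives, given the gains. -/
lemma signal_power (hρ : 0 ≤ ρ) (h g₁ g₂ : ℂ) {m : ℕ}
    (hm : m ≤ outageTime M (Real.log C.K / ((M : ℝ) * T)) (ρ * sw / sv) h)
    (i : Fin M) (t : Fin T) :
    (∀ ω, Integrable (fun v => ‖g₁ * C.xs ω i t + g₂ * C.relayOutput ω h v i t‖ ^ 2)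
      (noiseLaw M T sv)) ∧
    (C.K : ℝ)⁻¹ * ∑ ω, ∫ v, ‖g₁ * C.xs ω i t + g₂ * C.relayOutput ω h v i t‖ ^ 2
        ∂(noiseLaw M T sv) ≤
      sw * if (i : ℕ) < m then ‖g₁‖ ^ 2 * ρ else 2 * (‖g₁‖ ^ 2 + ‖g₂‖ ^ 2) * ρ := by
  have hE : 0 ≤ ρ * sw := by positivity
  have hsrc := average_le_of_lintegral (ν := noiseLaw M T sv) C.K_ne_zero
    (f := fun ω _ => ‖C.xs ω i t‖ ^ 2) (fun ω => measurable_const) (fun ω _ => sq_nonneg _) hE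
    (by
      simp_rw [ofReal_sq_norm, lintegral_const, measure_univ, mul_one]
      exact C.source_power i t)
  have hrel := average_le_of_lintegral (ν := noiseLaw M T sv) C.K_ne_zero
    (f := fun ω v => ‖C.relayOutput ω h v i t‖ ^ 2)
    (fun ω => by
      have : Measurable fun v => C.relayOutput ω h v :=
        (C.measurable_relayOutput ω).comp measurable_prodMk_left
      fun_prop) (fun ω _ => sq_nonneg _) hE
    (by
      simp_rw [ofReal_sq_norm]
      exact C.relay_power h i t)
  have hKpos : (0 : ℝ) < C.K := by exact_mod_cast Nat.pos_of_ne_zero C.K_ne_zero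
  by_cases him : (i : ℕ) < m
  · have hzero : ∀ ω v, C.relayOutput ω h v i t = 0 := fun ω v => by
      have := C.outageTime_le h (C.relayInput ω h v)
      exact if_neg (by omega)
    simp only [hzero, mul_zero, add_zero, if_pos him, norm_mul, mul_pow]
    refine ⟨fun ω => integrable_const _, ?_⟩
    simp_rw [integral_const_mul]
    rw [← Finset.mul_sum, mul_left_comm]
    calc _ ≤ ‖g₁‖ ^ 2 * (ρ * sw) := mul_le_mul_of_nonneg_left hsrc.2 (sq_nonneg _)
      _ = _ := by ring
  · rw [if_neg him]
    -- The relay signal may be correlated with the source signal, hence `|a + b|² ≤ 2|a|² + 2|b|²`;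
    -- the factor 2 is invisible to the exponents.
    have hle : ∀ ω v, ‖g₁ * C.xs ω i t + g₂ * C.relayOutput ω h v i t‖ ^ 2 ≤
        2 * ‖g₁‖ ^ 2 * ‖C.xs ω i t‖ ^ 2 + 2 * ‖g₂‖ ^ 2 * ‖C.relayOutput ω h v i t‖ ^ 2 := by
      intro ω v
      have h1 := norm_add_le (g₁ * C.xs ω i t) (g₂ * C.relayOutput ω h v i t)
      rw [norm_mul, norm_mul] at h1
      have h0 := norm_nonneg (g₁ * C.xs ω i t + g₂ * C.relayOutput ω h v i t)
      nlinarith [sq_nonneg (‖g₁‖ * ‖C.xs ω i t‖ - ‖g₂‖ * ‖C.relayOutput ω h v i t‖)]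
    have hdom : ∀ ω, Integrable (fun v => 2 * ‖g₁‖ ^ 2 * ‖C.xs ω i t‖ ^ 2 +
        2 * ‖g₂‖ ^ 2 * ‖C.relayOutput ω h v i t‖ ^ 2) (noiseLaw M T sv) := fun ω =>
      ((hsrc.1 ω).const_mul _).add ((hrel.1 ω).const_mul _)
    have hint : ∀ ω, Integrable
        (fun v => ‖g₁ * C.xs ω i t + g₂ * C.relayOutput ω h v i t‖ ^ 2) (noiseLaw M T sv) := by
      intro ω
      refine (hdom ω).mono' ?_ (ae_of_all _ fun v => ?_)
      · have : Measurable fun v => C.relayOutput ω h v :=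
          (C.measurable_relayOutput ω).comp measurable_prodMk_left
        exact (by fun_prop : Measurable fun v =>
          ‖g₁ * C.xs ω i t + g₂ * C.relayOutput ω h v i t‖ ^ 2).aestronglyMeasurable
      · rw [Real.norm_of_nonneg (sq_nonneg _)]
        exact hle ω v
    refine ⟨hint, ?_⟩
    have hsum : ∑ ω, ∫ v, ‖g₁ * C.xs ω i t + g₂ * C.relayOutput ω h v i t‖ ^ 2
        ∂(noiseLaw M T sv) ≤ ∑ ω, (2 * ‖g₁‖ ^ 2 * ∫ _, ‖C.xs ω i t‖ ^ 2 ∂(noiseLaw M T sv) +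
          2 * ‖g₂‖ ^ 2 * ∫ v, ‖C.relayOutput ω h v i t‖ ^ 2 ∂(noiseLaw M T sv)) := by
      refine Finset.sum_le_sum fun ω _ => ?_
      rw [← integral_const_mul, ← integral_const_mul, ← integral_add ((hsrc.1 ω).const_mul _)
        ((hrel.1 ω).const_mul _)]
      exact integral_mono (hint ω) (hdom ω) (hle ω)
    rw [Finset.sum_add_distrib, ← Finset.mul_sum, ← Finset.mul_sum] at hsum
    have h1 := mul_le_mul_of_nonneg_left hsum (inv_pos.2 hKpos).le
    have h2 := mul_le_mul_of_nonneg_left hsrc.2 (by positivity : 0 ≤ 2 * ‖g₁‖ ^ 2)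
    have h3 := mul_le_mul_of_nonneg_left hrel.2 (by positivity : 0 ≤ 2 * ‖g₂‖ ^ 2)
    calc _ ≤ _ := h1
      _ = _ := mul_add _ _ _
      _ ≤ 2 * ‖g₁‖ ^ 2 * (ρ * sw) + 2 * ‖g₂‖ ^ 2 * (ρ * sw) := by
        refine add_le_add ?_ ?_
        · rw [mul_left_comm]; exact h2
        · rw [mul_left_comm]; exact h3
      _ = _ := by ring

/-- Whether the destination is right, given the message and the gains, as an event on the
noises. -/
def correctEvent (ω : Fin C.K) (h g₁ g₂ : ℂ) : Set (Block M T × Block M T) :=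
  {p | C.dest (C.time h (C.relayInput ω h p.1)) g₁ g₂ (C.destInput ω h g₁ g₂ p.1 p.2) = ω}

/-- Fano's inequality for the `m`-switch channel, given the channel gains; the decision times
from `m` to `M` are possible. -/
lemma fano (hsw : 0 < sw) (hρ : 0 ≤ ρ) (h g₁ g₂ : ℂ) {m : ℕ} (hmM : m ≤ M)
    (hm : m ≤ outageTime M (Real.log C.K / ((M : ℝ) * T)) (ρ * sw / sv) h) {l : ℝ} (hl : 0 ≤ l) :
    l * ((C.K : ℝ)⁻¹ * ∑ ω, ((noiseLaw M T sv).prod (noiseLaw M T sw)).real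
        (C.correctEvent ω h g₁ g₂)) ≤
      m * T * Real.log (1 + ‖g₁‖ ^ 2 * ρ) +
      (M - m) * T * Real.log (1 + 2 * (‖g₁‖ ^ 2 + ‖g₂‖ ^ 2) * ρ) +
      Real.log (1 + Real.exp l * (M + 1 - m) / C.K) := by
  set gain : Fin M → ℝ := fun i =>
    if (i : ℕ) < m then ‖g₁‖ ^ 2 * ρ else 2 * (‖g₁‖ ^ 2 + ‖g₂‖ ^ 2) * ρ with hgain
  have hgain0 : ∀ i, 0 ≤ gain i := fun i => by
    simp only [hgain]; split_ifs <;> positivity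
  -- This variance dominates the output power averaged over the messages, so each symbol costs at
  -- most `log (1 + gain i)`. It is the same for all messages: a single message may exceed the power
  -- bound.
  let τ : Fin M → ℝ≥0 := fun i => sw * (1 + gain i).toNNReal
  have hτc : ∀ i, ((τ i : ℝ≥0) : ℝ) = sw * (1 + gain i) := fun i => by
    have := hgain0 i
    simp only [τ, NNReal.coe_mul]
    rw [Real.coe_toNNReal _ (by linarith)]
  have hsw' : (0 : ℝ) < sw := hsw
  have hτ : ∀ i, 0 < τ i := fun i => by
    have := hgain0 i
    rw [← NNReal.coe_pos, hτc]; positivity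
  have hKpos : (0 : ℝ) < C.K := by exact_mod_cast Nat.pos_of_ne_zero C.K_ne_zero
  have hpow := fun i t => C.signal_power hρ h g₁ g₂ hm i t
  -- The decision time is a random number in `[m, M]`. Uniting the decoding regions over its
  -- possible values removes it; each value contributes total mass one over the messages, whence `M
  -- + 1 - m`.
  let D : Fin C.K → Set (Block M T) := fun ω =>
    ⋃ k ∈ Finset.Icc m M, (fun y => C.dest k g₁ g₂ y) ⁻¹' {ω}
  have hdm : ∀ k, Measurable fun y => C.dest k g₁ g₂ y := fun k =>
    (C.measurable_dest k).comp
      (f := fun y : Block M T => (g₁, g₂, y)) (by fun_prop)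
  have hDm : ∀ ω, MeasurableSet (D ω) := fun ω =>
    Finset.measurableSet_biUnion _ fun k _ => hdm k (measurableSet_singleton ω)
  let s : Fin C.K → Block M T → Block M T := fun ω v i t =>
    g₁ * C.xs ω i t + g₂ * C.relayOutput ω h v i t
  have hsm : ∀ ω, Measurable (s ω) := fun ω => by
    have : Measurable fun v => C.relayOutput ω h v :=
      (C.measurable_relayOutput ω).comp measurable_prodMk_left
    refine measurable_pi_lambda _ fun i => measurable_pi_lambda _ fun t => ?_
    fun_prop
  have hDsum : ∑ ω, (blockLaw M T τ).real (D ω) ≤ M + 1 - m := by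
    calc ∑ ω, (blockLaw M T τ).real (D ω)
        ≤ ∑ ω, ∑ k ∈ Finset.Icc m M,
          (blockLaw M T τ).real ((fun y => C.dest k g₁ g₂ y) ⁻¹' {ω}) :=
          Finset.sum_le_sum fun ω _ => measureReal_biUnion_finset_le _ _
      _ = ∑ k ∈ Finset.Icc m M, ∑ ω,
          (blockLaw M T τ).real ((fun y => C.dest k g₁ g₂ y) ⁻¹' {ω}) := Finset.sum_comm
      _ = ∑ k ∈ Finset.Icc m M, 1 := by
          refine Finset.sum_congr rfl fun k _ => ?_
          rw [sum_measureReal_preimage_singleton _ fun ω _ => hdm k (measurableSet_singleton ω)]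
          simp
      _ = M + 1 - m := by
          rw [Finset.sum_const, Nat.card_Icc, nsmul_eq_mul, mul_one, Nat.cast_sub (by omega)]
          push_cast; ring
  -- An upper bound for the average over messages of `1 + exp l * (blockLaw M T τ).real (D ω)`.
  -- Sharing it between messages plays the role of concavity of the logarithm.
  set B : ℝ := 1 + Real.exp l * (M + 1 - m) / C.K with hBdef
  have hmM' : (m : ℝ) ≤ M := by exact_mod_cast hmM
  have hB : 0 < B := by
    have : 0 ≤ Real.exp l * ((M : ℝ) + 1 - m) / C.K :=
      div_nonneg (mul_nonneg (Real.exp_pos l).le (by linarith)) hKpos.le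
    rw [hBdef]; linarith
  have hmsg : ∀ ω, l * ((noiseLaw M T sv).prod (noiseLaw M T sw)).real (C.correctEvent ω h g₁ g₂) ≤
      (1 + Real.exp l * (blockLaw M T τ).real (D ω)) / B + Real.log B - 1 -
      ∑ i, ∑ t, (Real.log (sw / τ i) + 1 -
        (∫ v, ‖s ω v i t‖ ^ 2 ∂(noiseLaw M T sv) + sw) / τ i) := by
    intro ω
    have hg := gibbs_gaussian_channel (ν := noiseLaw M T sv) hsw hτ (hsm ω)
      (fun i t => (hpow i t).1 ω) (hDm ω) l hB
    have hsub : C.correctEvent ω h g₁ g₂ ⊆ {p | s ω p.1 + p.2 ∈ D ω} := by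
      intro p hp
      have h1 := C.outageTime_le h (C.relayInput ω h p.1)
      have h2 := C.time_le h (C.relayInput ω h p.1)
      refine Set.mem_biUnion (x := C.time h (C.relayInput ω h p.1))
        (Finset.mem_coe.2 (Finset.mem_Icc.2 ⟨hm.trans h1, h2⟩)) hp
    have := mul_le_mul_of_nonneg_left
      (measureReal_mono (μ := (noiseLaw M T sv).prod (noiseLaw M T sw)) hsub) hl
    linarith
  have hsumm := Finset.sum_le_sum fun ω (_ : ω ∈ Finset.univ) => hmsg ω
  rw [← Finset.mul_sum, Finset.sum_sub_distrib, Finset.sum_sub_distrib, Finset.sum_add_distrib,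
    ← Finset.sum_div, Finset.sum_add_distrib, ← Finset.mul_sum] at hsumm
  simp only [Finset.sum_const, Finset.card_univ, Fintype.card_fin, nsmul_eq_mul, mul_one] at hsumm
  have hlog : ∀ i t, -Real.log (1 + gain i) ≤ (C.K : ℝ)⁻¹ * ∑ ω, (Real.log (sw / τ i) + 1 -
      (∫ v, ‖s ω v i t‖ ^ 2 ∂(noiseLaw M T sv) + sw) / τ i) := by
    intro i t
    have hg := hgain0 i
    have hp : (C.K : ℝ)⁻¹ * ∑ ω, ∫ v, ‖s ω v i t‖ ^ 2 ∂(noiseLaw M T sv) ≤ sw * gain i :=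
      (hpow i t).2
    rw [Finset.sum_sub_distrib, ← Finset.sum_div, Finset.sum_add_distrib, Finset.sum_add_distrib]
    simp only [Finset.sum_const, Finset.card_univ, Fintype.card_fin, nsmul_eq_mul, hτc]
    have h1 : Real.log (sw / (sw * (1 + gain i))) = -Real.log (1 + gain i) := by
      rw [div_mul_cancel_left₀ hsw'.ne', Real.log_inv]
    rw [h1]
    set X := ∑ ω, ∫ v, ‖s ω v i t‖ ^ 2 ∂(noiseLaw M T sv)
    have h2 : (C.K : ℝ)⁻¹ * (C.K * -Real.log (1 + gain i) + C.K * 1 -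
        (X + C.K * sw) / (sw * (1 + gain i))) =
        -Real.log (1 + gain i) + (1 - ((C.K : ℝ)⁻¹ * X + sw) / (sw * (1 + gain i))) := by
      field_simp
      ring
    rw [h2]
    have h3 : ((C.K : ℝ)⁻¹ * X + sw) / (sw * (1 + gain i)) ≤ 1 := by
      rw [div_le_one (by positivity)]
      linarith
    linarith
  have hlogsum : -∑ i, ∑ _t : Fin T, Real.log (1 + gain i) ≤ (C.K : ℝ)⁻¹ * ∑ ω, ∑ i, ∑ t,
      (Real.log (sw / τ i) + 1 - (∫ v, ‖s ω v i t‖ ^ 2 ∂(noiseLaw M T sv) + sw) / τ i) := by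
    rw [Finset.sum_comm (s := (Finset.univ : Finset (Fin C.K))), Finset.mul_sum,
      ← Finset.sum_neg_distrib]
    refine Finset.sum_le_sum fun i _ => ?_
    rw [Finset.sum_comm (s := (Finset.univ : Finset (Fin C.K))), Finset.mul_sum,
      ← Finset.sum_neg_distrib]
    exact Finset.sum_le_sum fun t _ => hlog i t
  have hinfo : ∑ i, ∑ _t : Fin T, Real.log (1 + gain i) = m * T * Real.log (1 + ‖g₁‖ ^ 2 * ρ) +
      (M - m) * T * Real.log (1 + 2 * (‖g₁‖ ^ 2 + ‖g₂‖ ^ 2) * ρ) := by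
    simp only [Finset.sum_const, Finset.card_univ, Fintype.card_fin, nsmul_eq_mul]
    rw [← Finset.mul_sum, Fin.sum_univ_eq_sum_range (fun i => Real.log (1 + if i < m then
      ‖g₁‖ ^ 2 * ρ else 2 * (‖g₁‖ ^ 2 + ‖g₂‖ ^ 2) * ρ)) M,
      ← Finset.sum_range_add_sum_Ico _ hmM]
    rw [Finset.sum_congr rfl fun i hi => by rw [if_pos (Finset.mem_range.1 hi)],
      Finset.sum_congr (s₁ := Finset.Ico m M) rfl
        fun i hi => by rw [if_neg (not_lt.2 (Finset.mem_Ico.1 hi).1)]]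
    simp only [Finset.sum_const, Finset.card_range, Nat.card_Ico, nsmul_eq_mul,
      Nat.cast_sub hmM]
    ring
  have hfin := mul_le_mul_of_nonneg_left hsumm (inv_pos.2 hKpos).le
  have hexp := mul_le_mul_of_nonneg_left hDsum (Real.exp_pos l).le
  have hBle : (C.K : ℝ)⁻¹ * ((C.K + Real.exp l * ∑ ω, (blockLaw M T τ).real (D ω)) / B) ≤ 1 := by
    rw [← mul_div_assoc, div_le_one hB, mul_add, inv_mul_cancel₀ hKpos.ne', hBdef,
      inv_mul_eq_div]
    gcongr
  have hc1 : (C.K : ℝ)⁻¹ * (C.K * Real.log B) = Real.log B := inv_mul_cancel_left₀ hKpos.ne' _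
  have hc2 : (C.K : ℝ)⁻¹ * C.K = 1 := inv_mul_cancel₀ hKpos.ne'
  rw [mul_sub, mul_sub, mul_add, hc1, hc2, mul_left_comm] at hfin
  linarith

end Scheme

/-! ### From conditional error given the gains to the error probability. -/

/-- Integrates out one gain at a time; `Scheme.le_errorProb` applies it to `h`, `g₁` and `g₂` in
turn. -/
lemma mul_le_average_prod {α β : Type*} [MeasurableSpace α] [MeasurableSpace β] (μ : Measure α)
    (ν : Measure β) [SFinite ν] {K : ℕ} {E : Fin K → Set (α × β)} (hE : ∀ ω, MeasurableSet (E ω))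
    {H : Set α} (hH : MeasurableSet H) {c : ℝ≥0∞}
    (h : ∀ a ∈ H, c ≤ (K : ℝ≥0∞)⁻¹ * ∑ ω, ν (Prod.mk a ⁻¹' E ω)) :
    c * μ H ≤ (K : ℝ≥0∞)⁻¹ * ∑ ω, μ.prod ν (E ω) := by
  have hm : ∀ ω, Measurable fun a => ν (Prod.mk a ⁻¹' E ω) := fun ω =>
    measurable_measure_prodMk_left (hE ω)
  calc c * μ H = ∫⁻ _ in H, c ∂μ := (setLIntegral_const _ _).symm
    _ ≤ ∫⁻ a in H, (K : ℝ≥0∞)⁻¹ * ∑ ω, ν (Prod.mk a ⁻¹' E ω) ∂μ :=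
        setLIntegral_mono' hH h
    _ ≤ ∫⁻ a, (K : ℝ≥0∞)⁻¹ * ∑ ω, ν (Prod.mk a ⁻¹' E ω) ∂μ := setLIntegral_le_lintegral _ _
    _ = _ := by
        rw [lintegral_const_mul _ (Finset.measurable_fun_sum _ fun ω _ => hm ω),
          lintegral_finsetSum _ fun ω _ => hm ω]
        simp_rw [Measure.prod_apply (hE _)]

namespace Scheme

variable {M T : ℕ} {sw sv : ℝ≥0} {ρ : ℝ} (C : Scheme M T sw sv ρ)

/-- If the destination errs with conditional probability at least `c` for all gains in a box, the
error probability is at least `c` times the probability of the box. -/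
lemma le_errorProb {H G₁ G₂ : Set ℂ} (hH : MeasurableSet H) (hG₁ : MeasurableSet G₁)
    (hG₂ : MeasurableSet G₂) {c : ℝ}
    (h : ∀ h ∈ H, ∀ g₁ ∈ G₁, ∀ g₂ ∈ G₂, (C.K : ℝ)⁻¹ * ∑ ω,
      ((noiseLaw M T sv).prod (noiseLaw M T sw)).real (C.correctEvent ω h g₁ g₂) ≤ 1 - c) :
    ENNReal.ofReal c * complexNormal 1 G₂ * complexNormal 1 G₁ * complexNormal 1 H ≤
      C.errorProb := by
  have hm := C.measurableSet_error
  have hm1 := fun a ω => measurable_prodMk_left (x := a) (hm ω)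
  have hm2 := fun a b ω => measurable_prodMk_left (x := b) (hm1 a ω)
  have hm3 := fun a b d ω => measurable_prodMk_left (x := d) (hm2 a b ω)
  refine mul_le_average_prod _ _ hm hH fun a ha => ?_
  refine mul_le_average_prod _ _ (hm1 a) hG₁ fun g₁ hg₁ => ?_
  refine mul_le_average_prod _ _ (hm2 a g₁) hG₂ fun g₂ hg₂ => ?_
  have hKpos : (0 : ℝ) < C.K := by exact_mod_cast Nat.pos_of_ne_zero C.K_ne_zero
  have hc := h a ha g₁ hg₁ g₂ hg₂
  set π := (noiseLaw M T sv).prod (noiseLaw M T sw)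
  have hcompl : ∀ ω, π (Prod.mk g₂ ⁻¹' (Prod.mk g₁ ⁻¹' (Prod.mk a ⁻¹'
      {c : ℂ × ℂ × ℂ × Block M T × Block M T |
      C.dest (C.time c.1 (C.relayInput ω c.1 c.2.2.2.1)) c.2.1 c.2.2.1
        (C.destInput ω c.1 c.2.1 c.2.2.1 c.2.2.2.1 c.2.2.2.2) ≠ ω}))) =
      ENNReal.ofReal (1 - π.real (C.correctEvent ω a g₁ g₂)) := by
    intro ω
    have hcm : MeasurableSet (C.correctEvent ω a g₁ g₂) := by
      have := (hm3 a g₁ g₂ ω).compl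
      convert this using 1
      ext p
      simp [correctEvent]
    rw [← probReal_compl_eq_one_sub hcm, ofReal_measureReal]
    rfl
  simp_rw [hcompl]
  rw [← ENNReal.ofReal_sum_of_nonneg fun ω _ => sub_nonneg.2 measureReal_le_one,
    ← ENNReal.ofReal_natCast, ← ENNReal.ofReal_inv_of_pos hKpos,
    ← ENNReal.ofReal_mul (by positivity)]
  refine ENNReal.ofReal_le_ofReal ?_
  rw [Finset.sum_sub_distrib, mul_sub]
  simp only [Finset.sum_const, Finset.card_univ, Fintype.card_fin, nsmul_eq_mul, mul_one]
  rw [inv_mul_cancel₀ hKpos.ne']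
  linarith

end Scheme

/-! ### Calculus of SNR exponents. -/

/-- `P ρ` decays at least like `ρ ^ (-d)`, up to subpolynomial factors. -/
def DecayGE (P : ℝ → ℝ≥0∞) (d : EReal) : Prop :=
  ∀ c : ℝ, (c : EReal) < d → ∀ᶠ ρ in atTop, P ρ ≤ ENNReal.ofReal (ρ ^ (-c))

/-- `P ρ` decays at most like `ρ ^ (-d)`, up to subpolynomial factors. -/
def DecayLE (P : ℝ → ℝ≥0∞) (d : EReal) : Prop :=
  ∀ c : ℝ, d < c → ∀ᶠ ρ in atTop, ENNReal.ofReal (ρ ^ (-c)) ≤ P ρ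

lemma log_ofReal_rpow {ρ : ℝ} (hρ : 1 < ρ) (c : ℝ) :
    ENNReal.log (ENNReal.ofReal (ρ ^ (-c))) = -((c * Real.log ρ : ℝ) : EReal) := by
  have h0 : 0 < ρ := by linarith
  rw [ENNReal.log_ofReal, if_neg (not_le.2 (Real.rpow_pos_of_pos h0 _)), Real.log_rpow h0,
    ← EReal.coe_neg, neg_mul]

lemma le_snrExponent_iff {ρ : ℝ} (hρ : 1 < ρ) {P : ℝ≥0∞} {c : ℝ} :
    (c : EReal) ≤ snrExponent ρ P ↔ P ≤ ENNReal.ofReal (ρ ^ (-c)) := by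
  have hL : (0 : EReal) < (Real.log ρ : ℝ) := by exact_mod_cast Real.log_pos hρ
  rw [snrExponent, EReal.le_div_iff_mul_le hL (EReal.coe_ne_top _), ← ENNReal.log_le_log_iff,
    log_ofReal_rpow hρ, ← EReal.coe_mul, EReal.le_neg]

lemma snrExponent_le_iff {ρ : ℝ} (hρ : 1 < ρ) {P : ℝ≥0∞} {c : ℝ} :
    snrExponent ρ P ≤ c ↔ ENNReal.ofReal (ρ ^ (-c)) ≤ P := by
  have hL : (0 : EReal) < (Real.log ρ : ℝ) := by exact_mod_cast Real.log_pos hρ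
  rw [snrExponent, EReal.div_le_iff_le_mul hL (EReal.coe_ne_top _), ← ENNReal.log_le_log_iff,
    log_ofReal_rpow hρ, mul_comm, ← EReal.coe_mul, EReal.neg_le]

lemma tendsto_snrExponent {P : ℝ → ℝ≥0∞} {d : EReal} (h1 : DecayGE P d) (h2 : DecayLE P d) :
    Tendsto (fun ρ => snrExponent ρ (P ρ)) atTop (𝓝 d) := by
  refine tendsto_order.2 ⟨fun a ha => ?_, fun a ha => ?_⟩
  · obtain ⟨c, hc1, hc2⟩ := EReal.lt_iff_exists_real_btwn.1 ha
    filter_upwards [h1 c hc2, eventually_gt_atTop 1] with ρ hP hρ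
    exact hc1.trans_le ((le_snrExponent_iff hρ).2 hP)
  · obtain ⟨c, hc1, hc2⟩ := EReal.lt_iff_exists_real_btwn.1 ha
    filter_upwards [h2 c hc1, eventually_gt_atTop 1] with ρ hP hρ
    exact ((snrExponent_le_iff hρ).2 hP).trans_lt hc2

lemma le_of_tendsto_snrExponent {P : ℝ → ℝ≥0∞} {d e : EReal}
    (h : Tendsto (fun ρ => snrExponent ρ (P ρ)) atTop (𝓝 d)) (hP : DecayLE P e) : d ≤ e := by
  refine le_of_forall_gt fun a ha => ?_
  obtain ⟨c, hc1, hc2⟩ := EReal.lt_iff_exists_real_btwn.1 ha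
  refine lt_of_le_of_lt (le_of_tendsto h ?_) hc2
  filter_upwards [hP c hc1, eventually_gt_atTop 1] with ρ hP hρ
  exact (snrExponent_le_iff hρ).2 hP

lemma eventually_rpow_le_mul_rpow {k a b : ℝ} (hk : 0 < k) (hab : a < b) :
    ∀ᶠ ρ : ℝ in atTop, ρ ^ a ≤ k * ρ ^ b := by
  filter_upwards [(tendsto_rpow_atTop (sub_pos.2 hab)).eventually_ge_atTop k⁻¹,
    eventually_gt_atTop 0] with ρ hρ h0
  rw [Real.rpow_sub h0, le_div_iff₀ (Real.rpow_pos_of_pos h0 a), inv_mul_le_iff₀ hk] at hρ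
  exact hρ

lemma eventually_mul_rpow_le_rpow {k a b : ℝ} (hk : 0 < k) (hab : a < b) :
    ∀ᶠ ρ : ℝ in atTop, k * ρ ^ a ≤ ρ ^ b := by
  filter_upwards [eventually_rpow_le_mul_rpow (inv_pos.2 hk) hab] with ρ hρ
  rwa [← div_eq_inv_mul, le_div_iff₀' hk] at hρ

lemma decayGE_of_eventually_le {P : ℝ → ℝ≥0∞} {d k : ℝ} (hk : 0 < k)
    (h : ∀ᶠ ρ in atTop, P ρ ≤ ENNReal.ofReal (k * ρ ^ (-d))) : DecayGE P d := by
  intro c hc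
  have hc' : -d < -c := neg_lt_neg (EReal.coe_lt_coe_iff.1 hc)
  filter_upwards [h, eventually_mul_rpow_le_rpow hk hc'] with ρ h1 h2
  exact h1.trans (ENNReal.ofReal_le_ofReal h2)

lemma decayLE_of_eventually_le {P : ℝ → ℝ≥0∞} {d k : ℝ} (hk : 0 < k)
    (h : ∀ᶠ ρ in atTop, ENNReal.ofReal (k * ρ ^ (-d)) ≤ P ρ) : DecayLE P d := by
  intro c hc
  have hc' : -c < -d := neg_lt_neg (EReal.coe_lt_coe_iff.1 hc)
  filter_upwards [h, eventually_rpow_le_mul_rpow hk hc'] with ρ h1 h2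
  exact (ENNReal.ofReal_le_ofReal h2).trans h1

lemma DecayGE.mono {P Q : ℝ → ℝ≥0∞} {d : EReal} (h : DecayGE Q d)
    (hPQ : ∀ᶠ ρ in atTop, P ρ ≤ Q ρ) : DecayGE P d := fun c hc => by
  filter_upwards [h c hc, hPQ] with ρ h1 h2 using h2.trans h1

lemma DecayLE.mono {P Q : ℝ → ℝ≥0∞} {d : EReal} (h : DecayLE P d)
    (hPQ : ∀ᶠ ρ in atTop, P ρ ≤ Q ρ) : DecayLE Q d := fun c hc => by
  filter_upwards [h c hc, hPQ] with ρ h1 h2 using h1.trans h2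

/-- The slack `c - (d + e)` is shared between the factors. One exponent is real, so that the sum in
`EReal` is harmless; for `d = ⊤` there is nothing to prove. -/
lemma DecayLE.mul {P Q : ℝ → ℝ≥0∞} {d : EReal} {e : ℝ} (hP : DecayLE P d) (hQ : DecayLE Q e) :
    DecayLE (fun ρ => P ρ * Q ρ) (d + e) := by
  intro c hc
  have h1 : d < ((c - e : ℝ) : EReal) := by
    induction d with
    | bot => exact EReal.bot_lt_coe _
    | top => simp at hc
    | coe d => norm_cast at hc ⊢; linarith
  obtain ⟨c₁, hc1, hc2⟩ := EReal.lt_iff_exists_real_btwn.1 h1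
  have h2 : (e : EReal) < ((c - c₁ : ℝ) : EReal) := by norm_cast at hc2 ⊢; linarith
  filter_upwards [hP c₁ hc1, hQ _ h2, eventually_gt_atTop 0] with ρ h3 h4 h0
  calc ENNReal.ofReal (ρ ^ (-c))
      = ENNReal.ofReal (ρ ^ (-c₁)) * ENNReal.ofReal (ρ ^ (-(c - c₁))) := by
        rw [← ENNReal.ofReal_mul (Real.rpow_nonneg h0.le _), ← Real.rpow_add h0]
        congr 2; ring
    _ ≤ _ := mul_le_mul' h3 h4

lemma DecayGE.mul {P Q : ℝ → ℝ≥0∞} {d : EReal} {e : ℝ} (hP : DecayGE P d) (hQ : DecayGE Q e) :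
    DecayGE (fun ρ => P ρ * Q ρ) (d + e) := by
  intro c hc
  have h1 : ((c - e : ℝ) : EReal) < d := by
    induction d with
    | bot => simp at hc
    | top => exact EReal.coe_lt_top _
    | coe d => norm_cast at hc ⊢; linarith
  obtain ⟨c₁, hc1, hc2⟩ := EReal.lt_iff_exists_real_btwn.1 h1
  have h2 : ((c - c₁ : ℝ) : EReal) < e := by norm_cast at hc1 ⊢; linarith
  filter_upwards [hP c₁ hc2, hQ _ h2, eventually_gt_atTop 0] with ρ h3 h4 h0
  calc P ρ * Q ρ ≤ ENNReal.ofReal (ρ ^ (-c₁)) * ENNReal.ofReal (ρ ^ (-(c - c₁))) :=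
        mul_le_mul' h3 h4
    _ = ENNReal.ofReal (ρ ^ (-c)) := by
        rw [← ENNReal.ofReal_mul (Real.rpow_nonneg h0.le _), ← Real.rpow_add h0]
        congr 2; ring

/-- The number of terms is a constant, absorbed by the gap between two exponents below the minimum.
-/
lemma DecayGE.sum {ι : Type*} {s : Finset ι} {P : ι → ℝ → ℝ≥0∞} {d : ι → EReal}
    (h : ∀ i ∈ s, DecayGE (P i) (d i)) : DecayGE (fun ρ => ∑ i ∈ s, P i ρ) (⨅ i ∈ s, d i) := by
  intro c hc
  obtain ⟨c', hc1, hc2⟩ := EReal.lt_iff_exists_real_btwn.1 hc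
  have hall : ∀ᶠ ρ in atTop, ∀ i ∈ s, P i ρ ≤ ENNReal.ofReal (ρ ^ (-c')) :=
    (eventually_all_finset s).2 fun i hi => h i hi c' (hc2.trans_le (iInf₂_le i hi))
  have hcc : -c' < -c := neg_lt_neg (EReal.coe_lt_coe_iff.1 hc1)
  filter_upwards [hall, eventually_mul_rpow_le_rpow (k := s.card + 1) (by positivity) hcc,
    eventually_gt_atTop 0] with ρ h1 h2 h0
  have hp := Real.rpow_nonneg h0.le (-c')
  calc ∑ i ∈ s, P i ρ ≤ ∑ i ∈ s, ENNReal.ofReal (ρ ^ (-c')) := Finset.sum_le_sum h1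
    _ = ENNReal.ofReal (s.card * ρ ^ (-c')) := by
        rw [Finset.sum_const, nsmul_eq_mul, ENNReal.ofReal_mul (by positivity),
          ENNReal.ofReal_natCast]
    _ ≤ _ := ENNReal.ofReal_le_ofReal (le_trans (by linarith) h2)

/-! ### The outage-based decision time as a condition on `|h|²`. -/

section OutageTime

variable {M m : ℕ} {R ρ' : ℝ} {h : ℂ}

lemma outageTime_le_self (M : ℕ) (R ρ' : ℝ) (h : ℂ) : outageTime M R ρ' h ≤ M :=
  Nat.sInf_le (Or.inl rfl)

lemma log_gain_nonneg (hρ' : 0 ≤ ρ') (h : ℂ) : 0 ≤ Real.log (1 + ‖h‖ ^ 2 * ρ') :=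
  Real.log_nonneg (by have : 0 ≤ ‖h‖ ^ 2 * ρ' := by positivity
                      linarith)

/-- Accumulated information is nondecreasing in the number of slots, so outage at slot `m - 1`
implies outage at all earlier ones. -/
lemma le_outageTime (hmM : m ≤ M) (hρ' : 0 ≤ ρ')
    (hm : ((m : ℝ) - 1) * Real.log (1 + ‖h‖ ^ 2 * ρ') ≤ M * R) : m ≤ outageTime M R ρ' h := by
  refine le_csInf ⟨M, Or.inl rfl⟩ fun b hb => ?_
  rcases hb with rfl | ⟨_, hb⟩
  · exact hmM
  · by_contra hlt
    have : (b : ℝ) ≤ m - 1 := by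
      have : b + 1 ≤ m := by omega
      have : (b : ℝ) + 1 ≤ m := by exact_mod_cast this
      linarith
    have := mul_le_mul_of_nonneg_right this (log_gain_nonneg hρ' h)
    linarith

lemma of_le_outageTime (hm1 : 2 ≤ m) (hm : m ≤ outageTime M R ρ' h) :
    ((m : ℝ) - 1) * Real.log (1 + ‖h‖ ^ 2 * ρ') ≤ M * R := by
  have hnot : m - 1 ∉ {k : ℕ | k = M ∨
      (1 ≤ k ∧ (M : ℝ) * R < (k : ℝ) * Real.log (1 + ‖h‖ ^ 2 * ρ'))} :=
    Nat.notMem_of_lt_sInf (lt_of_lt_of_le (by omega) hm)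
  by_contra hlt
  refine hnot (Or.inr ⟨by omega, ?_⟩)
  rw [Nat.cast_sub (by omega), Nat.cast_one]
  linarith

lemma of_outageTime_eq (hmM : m < M) (hm : outageTime M R ρ' h = m) :
    M * R < m * Real.log (1 + ‖h‖ ^ 2 * ρ') := by
  have hmem := Nat.sInf_mem (s := {k : ℕ | k = M ∨
      (1 ≤ k ∧ (M : ℝ) * R < (k : ℝ) * Real.log (1 + ‖h‖ ^ 2 * ρ'))}) ⟨M, Or.inl rfl⟩
  change outageTime M R ρ' h ∈ _ at hmem
  rw [hm] at hmem
  rcases hmem with h1 | h1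
  · omega
  · exact h1.2

/-- The outer radius keeps slot `m - 1` in outage and the inner one makes slot `m` succeed. The
inner condition is superfluous when `m = M`, but does not affect exponents. -/
lemma annulus_subset_outageTime {a b : ℝ} (hm1 : 1 ≤ m) (hmM : m ≤ M) (hρ' : 0 < ρ')
    (ha : 0 ≤ a) (hb : ((m : ℝ) - 1) * Real.log (1 + b * ρ') ≤ M * R)
    (haR : M * R ≤ m * Real.log (1 + a * ρ')) :
    {h : ℂ | a < ‖h‖ ^ 2 ∧ ‖h‖ ^ 2 ≤ b} ⊆ {h | outageTime M R ρ' h = m} := by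
  rintro h ⟨h1, h2⟩
  have hm1' : (1 : ℝ) ≤ m := by exact_mod_cast hm1
  refine le_antisymm (Nat.sInf_le (Or.inr ⟨hm1, haR.trans_lt ?_⟩)) (le_outageTime hmM hρ'.le ?_)
  · have : Real.log (1 + a * ρ') < Real.log (1 + ‖h‖ ^ 2 * ρ') :=
      Real.log_lt_log (by positivity) (by gcongr)
    exact mul_lt_mul_of_pos_left this (by linarith)
  · refine le_trans (mul_le_mul_of_nonneg_left ?_ (by linarith)) hb
    exact Real.log_le_log (by positivity) (by gcongr)

end OutageTime

/-! ### Exponent of the law of the decision time. -/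

section TimeProb

variable {M m : ℕ} {sw sv : ℝ≥0} {r : ℝ}

lemma relaySnr_eq (hsw : 0 < sw) (hsv : 0 < sv) (ρ : ℝ) :
    ρ * sw / sv = ρ / ((sv : ℝ) / sw) := by
  have h1 : (0 : ℝ) < sw := hsw
  have h2 : (0 : ℝ) < sv := hsv
  field_simp

/-- Outage at slot `m - 1` confines `h` to a disc of squared radius of order `ρ ^ (M r / (m - 1) -
1)`. -/
lemma timeProb_decayGE_of_le (hsw : 0 < sw) (hsv : 0 < sv) (hm : 2 ≤ m) :
    DecayGE (timeProb M sw sv m r) ((1 - M * r / ((m : ℝ) - 1) : ℝ) : EReal) := by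
  have h1 : (0 : ℝ) < sw := hsw
  have h2 : (0 : ℝ) < sv := hsv
  have hm' : (0 : ℝ) < (m : ℝ) - 1 := by
    have : (2 : ℝ) ≤ m := by exact_mod_cast hm
    linarith
  refine decayGE_of_eventually_le (k := (sv : ℝ) / sw) (by positivity) ?_
  filter_upwards [eventually_gt_atTop 1] with ρ hρ
  have h0 : 0 < ρ := by linarith
  have hk : 0 < (sv : ℝ) / sw * ρ ^ (-(1 - M * r / ((m : ℝ) - 1))) := by positivity
  refine le_trans (measure_mono fun h hh => ?_) (complexNormal_sq_norm_le hk.le)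
  have hout := of_le_outageTime hm (ge_of_eq hh)
  rw [relaySnr_eq hsw hsv, mul_comm, ← le_div_iff₀ hm', mul_div_right_comm] at hout
  have hle : Real.log (1 + ‖h‖ ^ 2 * (ρ / (sv / sw))) ≤
      Real.log (ρ ^ (M * r / ((m : ℝ) - 1))) := by
    rw [Real.log_rpow h0]
    calc _ ≤ _ := hout
      _ = _ := by ring
  have hlt := (Real.log_le_log_iff (by positivity) (by positivity)).1 hle
  have : ‖h‖ ^ 2 * (ρ / (sv / sw)) ≤ ρ ^ (M * r / ((m : ℝ) - 1)) := by linarith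
  rw [← mul_div_assoc, div_le_iff₀ (by positivity)] at this
  rw [Set.mem_ofPred_eq, neg_sub, Real.rpow_sub_one h0.ne', ← mul_div_assoc, le_div_iff₀ h0]
  linarith

lemma eventually_exp_neg_rpow_le {k g : ℝ} (hk : 0 < k) (hg : 0 < g) (c : ℝ) :
    ∀ᶠ ρ : ℝ in atTop, Real.exp (-k * ρ ^ g) ≤ ρ ^ (-c) := by
  have h := (isLittleO_exp_neg_mul_rpow_atTop hk (-c / g)).bound one_pos
  filter_upwards [(tendsto_rpow_atTop hg).eventually h, eventually_gt_atTop 0] with ρ h1 h0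
  rw [Real.norm_of_nonneg (Real.exp_pos _).le, one_mul,
    Real.norm_of_nonneg (Real.rpow_nonneg (Real.rpow_nonneg h0.le _) _), ← Real.rpow_mul h0.le,
    mul_div_cancel₀ _ hg.ne'] at h1
  exact h1

/-- Deciding at slot `m` above rate `m / M` requires `|h|²` to be at least of order `ρ ^ g` with `g
> 0`, which is exponentially unlikely. -/
lemma timeProb_decayGE_top (hsw : 0 < sw) (hsv : 0 < sv) (hm : 1 ≤ m) (hmr : (m : ℝ) / M < r)
    (hr1 : r ≤ 1) (hM : 1 ≤ M) : DecayGE (timeProb M sw sv m r) ⊤ := by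
  intro c _
  have h1 : (0 : ℝ) < sw := hsw
  have h2 : (0 : ℝ) < sv := hsv
  have hM' : (0 : ℝ) < M := by exact_mod_cast hM
  have hm' : (0 : ℝ) < m := by exact_mod_cast hm
  have hmM : m < M := by
    have := hmr.trans_le hr1
    rw [div_lt_one hM'] at this
    exact_mod_cast this
  rw [div_lt_iff₀ hM'] at hmr
  set κ := (sv : ℝ) / sw with hκ
  have hκ0 : 0 < κ := by positivity
  set g := M * r / m - 1 with hg
  have hg0 : 0 < g := by
    rw [hg, sub_pos, one_lt_div hm']; linarith
  -- The prefactor of the tail bound; asking for exponent `c + 1` leaves one power of `ρ` to absorb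
  -- it.
  have hk2 : 0 < 2 * Real.exp (κ / 2) := by positivity
  filter_upwards [eventually_gt_atTop 1, eventually_exp_neg_rpow_le (half_pos hκ0) hg0 (c + 1),
    eventually_mul_rpow_le_rpow hk2 (show -(c + 1) < -c by linarith)] with ρ hρ he hc
  have h0 : 0 < ρ := by linarith
  have hsub : {h : ℂ | outageTime M (r * Real.log ρ) (ρ * sw / sv) h = m} ⊆
      {h | κ * ρ ^ g - κ < ‖h‖ ^ 2} := by
    intro h hh
    have hout := of_outageTime_eq hmM hh
    rw [relaySnr_eq hsw hsv, ← hκ] at hout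
    have hlt : Real.log (ρ ^ (M * r / m)) < Real.log (1 + ‖h‖ ^ 2 * (ρ / κ)) := by
      rw [Real.log_rpow h0, div_mul_eq_mul_div, div_lt_iff₀ hm']
      linarith
    have hlt' := (Real.log_lt_log_iff (by positivity) (by positivity)).1 hlt
    have hgp : ρ ^ g = ρ ^ (M * r / m) / ρ := by rw [hg, Real.rpow_sub_one h0.ne']
    rw [Set.mem_ofPred_eq, hgp]
    have h3 : ρ ^ (M * r / m) < 1 + ‖h‖ ^ 2 * ρ / κ := by
      rwa [mul_div_assoc (‖h‖ ^ 2)]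
    have h4 : ρ ^ (M * r / m) / ρ < ρ⁻¹ + ‖h‖ ^ 2 / κ := by
      rw [div_lt_iff₀ h0]
      calc _ < _ := h3
        _ = _ := by field_simp
    have h5 : ρ⁻¹ ≤ 1 := inv_le_one_of_one_le₀ hρ.le
    have h6 : ρ ^ (M * r / m) / ρ - 1 < ‖h‖ ^ 2 / κ := by linarith
    rw [lt_div_iff₀ hκ0] at h6
    linarith
  calc timeProb M sw sv m r ρ ≤ complexNormal 1 {h | κ * ρ ^ g - κ < ‖h‖ ^ 2} := measure_mono hsub
    _ ≤ ENNReal.ofReal (2 * Real.exp (-(κ * ρ ^ g - κ) / 2)) := complexNormal_lt_sq_norm _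
    _ ≤ ENNReal.ofReal (ρ ^ (-c)) := by
        refine ENNReal.ofReal_le_ofReal (le_trans ?_ hc)
        have : Real.exp (-(κ * ρ ^ g - κ) / 2) =
            Real.exp (κ / 2) * Real.exp (-(κ / 2) * ρ ^ g) := by
          rw [← Real.exp_add]; congr 1; ring
        rw [this, ← mul_assoc]
        gcongr

lemma timeProb_decayLE_of_le (hsw : 0 < sw) (hsv : 0 < sv) (hm : 2 ≤ m) (hmM : m ≤ M)
    (hr0 : 0 < r) (hr : r ≤ ((m : ℝ) - 1) / M) :
    DecayLE (timeProb M sw sv m r) ((1 - M * r / ((m : ℝ) - 1) : ℝ) : EReal) := by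
  have h1 : (0 : ℝ) < sw := hsw
  have h2 : (0 : ℝ) < sv := hsv
  have hm2 : (2 : ℝ) ≤ m := by exact_mod_cast hm
  have hm' : (0 : ℝ) < (m : ℝ) - 1 := by linarith
  have hM' : (0 : ℝ) < M := by exact_mod_cast (show 0 < M by omega)
  set κ := (sv : ℝ) / sw with hκ
  have hκ0 : 0 < κ := by positivity
  -- `β` and `α` are the exponents of `1 + |h|² ρ'` at which slots `m - 1` and `m` reach the rate.
  -- As `α < β`, the inner disc of the annulus is negligible.
  set β := M * r / ((m : ℝ) - 1) with hβ
  set α := M * r / (m : ℝ) with hα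
  have hα0 : 0 < α := by positivity
  have hαβ : α < β := div_lt_div_of_pos_left (by positivity) hm' (by linarith)
  have hβ1 : β ≤ 1 := by
    rw [hβ, div_le_one hm']
    rw [le_div_iff₀ hM'] at hr
    linarith
  refine decayLE_of_eventually_le (k := Real.exp (-κ) * (κ / 2)) (by positivity) ?_
  -- With `ρ ^ α` and `1` each at most `ρ ^ β / 4`, at least half of `ρ ^ β` remains in `ρ ^ β - 1 -
  -- ρ ^ α`.
  have h4 : (0 : ℝ) < 1 / 4 := by norm_num
  filter_upwards [eventually_gt_atTop 1, eventually_rpow_le_mul_rpow h4 hαβ,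
    eventually_rpow_le_mul_rpow h4 (hα0.trans hαβ)] with ρ hρ hρ1 hρ2
  have h0 : 0 < ρ := by linarith
  rw [Real.rpow_zero] at hρ2
  set a := κ * ρ ^ α / ρ with ha
  set b := κ * (ρ ^ β - 1) / ρ with hb
  have hba : κ / 2 * ρ ^ (-(1 - β)) ≤ b - a := by
    rw [neg_sub, Real.rpow_sub_one h0.ne', hb, ha, ← sub_div, ← mul_div_assoc]
    have : κ / 2 * ρ ^ β ≤ κ * (ρ ^ β - 1) - κ * ρ ^ α := by
      have : ρ ^ β / 2 ≤ ρ ^ β - 1 - ρ ^ α := by linarith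
      nlinarith
    gcongr
  have hab : a ≤ b := by
    have : 0 ≤ κ / 2 * ρ ^ (-(1 - β)) := by positivity
    linarith
  have hbκ : b ≤ κ := by
    rw [hb, div_le_iff₀ h0]
    have : ρ ^ β ≤ ρ ^ (1 : ℝ) := Real.rpow_le_rpow_of_exponent_le hρ.le hβ1
    rw [Real.rpow_one] at this
    nlinarith
  have hR : (M : ℝ) * (r * Real.log ρ) = ((m : ℝ) - 1) * Real.log (1 + b * (ρ / κ)) := by
    have : 1 + b * (ρ / κ) = ρ ^ β := by rw [hb]; field_simp; ring
    rw [this, Real.log_rpow h0, hβ]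
    field_simp
  have hR' : (M : ℝ) * (r * Real.log ρ) ≤ m * Real.log (1 + a * (ρ / κ)) := by
    have h5 : 1 + a * (ρ / κ) = 1 + ρ ^ α := by rw [ha]; field_simp
    have h6 : (M : ℝ) * (r * Real.log ρ) = m * Real.log (ρ ^ α) := by
      rw [Real.log_rpow h0, hα]; field_simp
    rw [h5, h6]
    gcongr
    linarith
  calc ENNReal.ofReal (Real.exp (-κ) * (κ / 2) * ρ ^ (-(1 - β)))
      ≤ ENNReal.ofReal (Real.exp (-b) * (b - a)) := by
        refine ENNReal.ofReal_le_ofReal ?_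
        rw [mul_assoc]
        gcongr
    _ ≤ complexNormal 1 {z | a < ‖z‖ ^ 2 ∧ ‖z‖ ^ 2 ≤ b} :=
        le_complexNormal_annulus (by positivity) hab
    _ ≤ _ := by
        refine measure_mono ?_
        rw [relaySnr_eq hsw hsv]
        exact annulus_subset_outageTime (by omega) hmM (by positivity) (by positivity) hR.ge hR'

lemma eventually_mul_log_le {k s t : ℝ} (hk : 0 ≤ k) (hs : 0 ≤ s) (hst : s < t) :
    ∀ᶠ ρ : ℝ in atTop, s * Real.log (1 + k * ρ) ≤ t * Real.log ρ := by
  filter_upwards [eventually_ge_atTop 1, Real.tendsto_log_atTop.eventually_ge_atTop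
    (s * Real.log (1 + k) / (t - s))] with ρ hρ hlog
  have h1 : Real.log (1 + k * ρ) ≤ Real.log (1 + k) + Real.log ρ := by
    rw [← Real.log_mul (by positivity) (by positivity)]
    refine Real.log_le_log (by positivity) ?_
    linarith
  rw [div_le_iff₀ (by linarith)] at hlog
  nlinarith [mul_le_mul_of_nonneg_left h1 hs]

/-- A fixed annulus `κ < |h|² ≤ κ + 1`, of mass independent of `ρ`, works: `κ` normalises the relay
SNR to `ρ`, and the strict inequality on `r` absorbs the constant inside the logarithm. -/
lemma timeProb_decayLE_zero (hsw : 0 < sw) (hsv : 0 < sv) (hm : 1 ≤ m) (hmM : m ≤ M)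
    (hr : r ≤ (m : ℝ) / M) (hmr : (m : ℝ) - 1 < M * r) :
    DecayLE (timeProb M sw sv m r) 0 := by
  have h1 : (0 : ℝ) < sw := hsw
  have h2 : (0 : ℝ) < sv := hsv
  have hm1 : (1 : ℝ) ≤ m := by exact_mod_cast hm
  have hM' : (0 : ℝ) < M := by exact_mod_cast (show 0 < M by omega)
  set κ := (sv : ℝ) / sw with hκ
  have hκ0 : 0 < κ := by positivity
  refine decayLE_of_eventually_le (d := 0) (k := Real.exp (-(κ + 1))) (by positivity) ?_
  filter_upwards [eventually_gt_atTop 1, eventually_mul_log_le (k := (κ + 1) / κ) (by positivity)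
    (by linarith) hmr] with ρ hρ hlog
  have h0 : 0 < ρ := by linarith
  have hb : ((m : ℝ) - 1) * Real.log (1 + (κ + 1) * (ρ / κ)) ≤ M * (r * Real.log ρ) := by
    calc _ = ((m : ℝ) - 1) * Real.log (1 + (κ + 1) / κ * ρ) := by congr 3; ring
      _ ≤ _ := hlog
      _ = _ := by ring
  have ha : M * (r * Real.log ρ) ≤ m * Real.log (1 + κ * (ρ / κ)) := by
    rw [mul_div_cancel₀ _ hκ0.ne']
    rw [le_div_iff₀ hM'] at hr
    have hl := Real.log_pos hρ
    calc M * (r * Real.log ρ) = r * M * Real.log ρ := by ring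
      _ ≤ m * Real.log ρ := by gcongr
      _ ≤ _ := by gcongr; linarith
  have := le_complexNormal_annulus hκ0.le (show κ ≤ κ + 1 by linarith)
  simp only [neg_zero, Real.rpow_zero]
  rw [add_sub_cancel_left] at this
  refine this.trans (measure_mono ?_)
  rw [relaySnr_eq hsw hsv]
  exact annulus_subset_outageTime hm hmM (by positivity) hκ0.le hb ha

lemma decayGE_zero_of_le_one {P : ℝ → ℝ≥0∞} (h : ∀ ρ, P ρ ≤ 1) : DecayGE P 0 :=
  decayGE_of_eventually_le (d := 0) one_pos <| Eventually.of_forall fun ρ => by simpa using h ρ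

lemma timeProb_decay (hM : 1 ≤ M) (hsw : 0 < sw) (hsv : 0 < sv) (hr0 : 0 < r) (hr1 : r ≤ 1)
    (hm : 1 ≤ m) (hmM : m ≤ M) :
    DecayGE (timeProb M sw sv m r) (dBar M m r) ∧
      DecayLE (timeProb M sw sv m r) (dBar M m r) := by
  have hM' : (0 : ℝ) < M := by exact_mod_cast hM
  rw [dBar]
  split_ifs with h1 h2
  · exact ⟨timeProb_decayGE_of_le hsw hsv (by omega),
      timeProb_decayLE_of_le hsw hsv (by omega) hmM hr0 h1.2⟩
  · refine ⟨decayGE_zero_of_le_one fun ρ => prob_le_one, timeProb_decayLE_zero hsw hsv hm hmM h2 ?_⟩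
    by_cases hm1 : m = 1
    · subst hm1
      simp only [Nat.cast_one, sub_self]
      positivity
    · have : ((m : ℝ) - 1) / M < r := not_le.1 fun h => h1 ⟨hm1, h⟩
      rw [div_lt_iff₀ hM'] at this
      linarith
  · exact ⟨timeProb_decayGE_top hsw hsv hm (not_le.1 h2) hr1 hM, fun c hc => absurd hc (by simp)⟩

end TimeProb

lemma DecayGE.rpow {P : ℝ → ℝ≥0∞} {d s : ℝ} (h : DecayGE P d) (hs : 0 ≤ s) :
    DecayGE (fun ρ => P ρ ^ s) ((s * d : ℝ) : EReal) := by
  rcases hs.eq_or_lt with rfl | hs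
  · simp only [ENNReal.rpow_zero, zero_mul]
    exact decayGE_zero_of_le_one fun _ => le_rfl
  · intro c hc
    have h1 : ((c / s : ℝ) : EReal) < d := by
      norm_cast at hc ⊢
      rwa [div_lt_iff₀' hs]
    filter_upwards [h _ h1, eventually_gt_atTop 0] with ρ h2 h0
    calc P ρ ^ s ≤ ENNReal.ofReal (ρ ^ (-(c / s))) ^ s := ENNReal.rpow_le_rpow h2 hs.le
      _ = ENNReal.ofReal (ρ ^ (-c)) := by
          rw [ENNReal.ofReal_rpow_of_pos (Real.rpow_pos_of_pos h0 _), ← Real.rpow_mul h0.le]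
          congr 2
          field_simp

lemma DecayLE.mono_exponent {P : ℝ → ℝ≥0∞} {d e : EReal} (h : DecayLE P d) (hde : d ≤ e) :
    DecayLE P e := fun c hc => h c (hde.trans_lt hc)

/-- Lets an optimal exponent be replaced by a perturbed one for which the rate constraints are
strict. -/
lemma decayLE_of_forall_add {P : ℝ → ℝ≥0∞} {d k : ℝ} (hk : 0 < k)
    (h : ∀ η : ℝ, 0 < η → η < 1 → DecayLE P ((d + k * η : ℝ) : EReal)) : DecayLE P d := by
  intro c hc
  norm_cast at hc
  obtain ⟨η, h1, h2⟩ := exists_between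
    (show 0 < min 1 ((c - d) / k) from lt_min one_pos (div_pos (by linarith) hk))
  refine h η h1 (h2.trans_le (min_le_left _ _)) c ?_
  have := h2.trans_le (min_le_right _ _)
  rw [lt_div_iff₀ hk] at this
  norm_cast
  linarith

/-! ### Outage exponent of the `m`-switch channel, by linear programming duality. -/

section SwitchOutage

/-- `1 / (1 + |g|² ρ)`. -/
def invGain (ρ : ℝ) (g : ℂ) : ℝ≥0∞ := ENNReal.ofReal (1 + ‖g‖ ^ 2 * ρ)⁻¹

lemma measurable_invGain (ρ : ℝ) : Measurable (invGain ρ) := by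
  unfold invGain; fun_prop

lemma lintegral_rpow_Ioo {e : ℝ} (he : 0 < e) {ρ : ℝ} (hρ : 0 < ρ) :
    ∫⁻ t in Set.Ioo (0 : ℝ) 1, ENNReal.ofReal ((t * ρ) ^ (-(1 - e))) =
      ENNReal.ofReal (e⁻¹ * ρ ^ (-(1 - e))) := by
  have hint : IntervalIntegrable (fun t : ℝ => t ^ (-(1 - e))) volume 0 1 :=
    intervalIntegral.intervalIntegrable_rpow' (by linarith)
  have hon : IntegrableOn (fun t : ℝ => t ^ (-(1 - e))) (Set.Ioo 0 1) :=
    (intervalIntegrable_iff_integrableOn_Ioo_of_le zero_le_one).1 hint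
  have hval : ∫ t in Set.Ioo (0 : ℝ) 1, t ^ (-(1 - e)) = e⁻¹ := by
    rw [← integral_Ioc_eq_integral_Ioo, ← intervalIntegral.integral_of_le zero_le_one,
      integral_rpow (Or.inl (by linarith)), Real.one_rpow, Real.zero_rpow (by linarith)]
    rw [sub_zero, one_div]
    congr 1; ring
  rw [ENNReal.ofReal_mul (by positivity), ← hval, ofReal_integral_eq_lintegral_ofReal hon,
    ← lintegral_mul_const _ (by fun_prop)]
  · refine setLIntegral_congr_fun measurableSet_Ioo fun t ht => ?_
    rw [Real.mul_rpow ht.1.le hρ.le, ENNReal.ofReal_mul (Real.rpow_nonneg ht.1.le _)]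
  · refine (ae_restrict_iff' measurableSet_Ioo).2 (ae_of_all _ fun t ht => ?_)
    exact Real.rpow_nonneg ht.1.le _

/-- By the layer-cake formula and `P (invGain > t) ≤ min 1 (tρ)⁻¹ ≤ (tρ)^-(1-e)`. The loss `e` makes
the bound integrable at `0` and avoids a logarithm. -/
lemma lintegral_invGain_le {e : ℝ} (he : 0 < e) (he1 : e < 1) {ρ : ℝ} (hρ : 0 < ρ) :
    ∫⁻ g, invGain ρ g ∂(complexNormal 1) ≤ ENNReal.ofReal (e⁻¹ * ρ ^ (-(1 - e))) := by
  have hlc := lintegral_eq_lintegral_meas_lt (complexNormal 1)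
    (f := fun g : ℂ => (1 + ‖g‖ ^ 2 * ρ)⁻¹) (ae_of_all _ fun g => by positivity)
    (by fun_prop)
  unfold invGain
  rw [hlc, ← lintegral_rpow_Ioo he hρ]
  have hsplit : Set.Ioi (0 : ℝ) = Set.Ioo 0 1 ∪ Set.Ici 1 := (Set.Ioo_union_Ici_eq_Ioi one_pos).symm
  have hzero : ∫⁻ t in Set.Ici (1 : ℝ), complexNormal 1 {g | t < (1 + ‖g‖ ^ 2 * ρ)⁻¹} = 0 := by
    rw [← lintegral_zero (μ := volume.restrict (Set.Ici (1 : ℝ)))]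
    refine setLIntegral_congr_fun measurableSet_Ici fun t ht => ?_
    have : {g : ℂ | t < (1 + ‖g‖ ^ 2 * ρ)⁻¹} = ∅ := by
      refine Set.eq_empty_iff_forall_notMem.2 fun g hg => ?_
      have h1 : (1 + ‖g‖ ^ 2 * ρ)⁻¹ ≤ 1 := inv_le_one_of_one_le₀ (by
        have : 0 ≤ ‖g‖ ^ 2 * ρ := by positivity
        linarith)
      exact absurd hg (not_lt.2 (h1.trans ht))
    simp [this]
  rw [hsplit]
  refine (lintegral_union_le _ _ _).trans ?_
  rw [hzero, add_zero]
  refine setLIntegral_mono (by fun_prop) fun t ht => ?_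
  have ht0 : 0 < t * ρ := mul_pos ht.1 hρ
  have hle : complexNormal 1 {g | t < (1 + ‖g‖ ^ 2 * ρ)⁻¹} ≤ ENNReal.ofReal (t * ρ)⁻¹ := by
    refine le_trans (measure_mono fun g hg => ?_) (complexNormal_sq_norm_le (inv_pos.2 ht0).le)
    have h1 : t < (1 + ‖g‖ ^ 2 * ρ)⁻¹ := hg
    have h2 : (0 : ℝ) < 1 + ‖g‖ ^ 2 * ρ := by positivity
    rw [lt_inv_comm₀ ht.1 h2] at h1
    rw [Set.mem_ofPred_eq, mul_inv, ← div_eq_mul_inv, le_div_iff₀ hρ]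
    linarith
  rw [Real.rpow_neg ht0.le, ← Real.inv_rpow ht0.le]
  set y := (t * ρ)⁻¹
  have hy : 0 < y := inv_pos.2 ht0
  rcases le_total y 1 with hy1 | hy1
  · refine hle.trans (ENNReal.ofReal_le_ofReal ?_)
    calc y = y ^ (1 : ℝ) := (Real.rpow_one y).symm
      _ ≤ y ^ (1 - e) := Real.rpow_le_rpow_of_exponent_ge hy hy1 (by linarith)
  · refine prob_le_one.trans ?_
    rw [ENNReal.one_le_ofReal]
    exact Real.one_le_rpow hy1 (by linarith)

lemma decayGE_lintegral_invGain :
    DecayGE (fun ρ => ∫⁻ g, invGain ρ g ∂(complexNormal 1)) ((1 : ℝ) : EReal) := by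
  intro c hc
  norm_cast at hc
  obtain ⟨e, h1, h2⟩ := exists_between (show 0 < min 1 (1 - c) from lt_min one_pos (by linarith))
  have he1 := h2.trans_le (min_le_left _ _)
  have he2 := h2.trans_le (min_le_right _ _)
  filter_upwards [eventually_mul_rpow_le_rpow (k := e⁻¹) (inv_pos.2 h1)
    (show -(1 - e) < -c by linarith), eventually_gt_atTop 0] with ρ h3 h0
  exact (lintegral_invGain_le h1 he1 h0).trans (ENNReal.ofReal_le_ofReal h3)

/-- Jensen's inequality for the concave power `s`, read off the monotonicity of `L^p` norms on a
probability space. -/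
lemma lintegral_rpow_le_rpow_lintegral {α : Type*} [MeasurableSpace α] {μ : Measure α}
    [IsProbabilityMeasure μ] {f : α → ℝ≥0∞} (hf : Measurable f) {s : ℝ} (hs0 : 0 ≤ s)
    (hs1 : s ≤ 1) : ∫⁻ a, f a ^ s ∂μ ≤ (∫⁻ a, f a ∂μ) ^ s := by
  rcases hs0.eq_or_lt with rfl | hs0
  · simp
  · have h := eLpNorm'_le_eLpNorm'_of_exponent_le (μ := μ) hs0 hs1 hf.aestronglyMeasurable
    simp only [eLpNorm', enorm_eq_self, ENNReal.rpow_one, one_div, inv_one] at h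
    have := ENNReal.rpow_le_rpow h hs0.le
    rwa [← ENNReal.rpow_mul, inv_mul_cancel₀ hs0.ne', ENNReal.rpow_one] at this

/-- Markov's inequality for `ρ ^ c (1 + |g₁|² ρ)⁻¹ (1 + |g₂|² ρ)^(-s)`, then independence. The first
gain has weight one, the second the dual weight `s`. -/
lemma chernoff_two_gains {s c : ℝ} (hs0 : 0 ≤ s) (hs1 : s ≤ 1) {ρ : ℝ} (hρ : 0 < ρ) :
    (complexNormal 1).prod (complexNormal 1) {g : ℂ × ℂ | Real.log (1 + ‖g.1‖ ^ 2 * ρ) +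
      s * Real.log (1 + ‖g.2‖ ^ 2 * ρ) ≤ c * Real.log ρ} ≤
    ENNReal.ofReal (ρ ^ c) * ((∫⁻ g, invGain ρ g ∂(complexNormal 1)) *
      (∫⁻ g, invGain ρ g ∂(complexNormal 1)) ^ s) := by
  have hm := measurable_invGain ρ
  calc _ ≤ (complexNormal 1).prod (complexNormal 1) {g : ℂ × ℂ |
        1 ≤ ENNReal.ofReal (ρ ^ c) * (invGain ρ g.1 * invGain ρ g.2 ^ s)} := by
        refine measure_mono fun g hg => ?_
        have h1 : (0 : ℝ) < 1 + ‖g.1‖ ^ 2 * ρ := by positivity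
        have h2 : (0 : ℝ) < 1 + ‖g.2‖ ^ 2 * ρ := by positivity
        rw [Set.mem_ofPred_eq, invGain, invGain, ENNReal.ofReal_rpow_of_pos (inv_pos.2 h2),
          ← ENNReal.ofReal_mul (inv_pos.2 h1).le, ← ENNReal.ofReal_mul (by positivity),
          ENNReal.one_le_ofReal, Real.inv_rpow h2.le, ← mul_inv, ← div_eq_mul_inv,
          one_le_div (by positivity), ← Real.log_le_log_iff (by positivity) (by positivity),
          Real.log_mul h1.ne' (by positivity), Real.log_rpow h2, Real.log_rpow hρ]
        exact hg
    _ ≤ ∫⁻ g : ℂ × ℂ, ENNReal.ofReal (ρ ^ c) * (invGain ρ g.1 * invGain ρ g.2 ^ s)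
          ∂((complexNormal 1).prod (complexNormal 1)) := by
        have := mul_meas_ge_le_lintegral (μ := (complexNormal 1).prod (complexNormal 1))
          (f := fun g : ℂ × ℂ => ENNReal.ofReal (ρ ^ c) * (invGain ρ g.1 * invGain ρ g.2 ^ s))
          (by fun_prop) 1
        rwa [one_mul] at this
    _ = ENNReal.ofReal (ρ ^ c) * ((∫⁻ g, invGain ρ g ∂(complexNormal 1)) *
          ∫⁻ g, invGain ρ g ^ s ∂(complexNormal 1)) := by
        rw [lintegral_const_mul _ (by fun_prop), lintegral_prod_mul hm.aemeasurable
          (hm.pow_const s).aemeasurable]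
    _ ≤ _ := by
        gcongr
        exact lintegral_rpow_le_rpow_lintegral hm hs0 hs1

variable {M T m : ℕ} {r : ℝ}

/-- Dual certificate for the linear program whose value is `dSwitch`. -/
lemma exists_dSwitch_dual (hm : 1 ≤ m) (hmM : m ≤ M) (hr0 : 0 ≤ r) :
    ∃ s c : ℝ, 0 ≤ s ∧ s ≤ 1 ∧ dSwitch M m r = 1 + s - c ∧
      ∀ a b e L : ℝ, 0 ≤ a → a ≤ e → b ≤ e → m * a + (M - m) * e ≤ M * (r * L) →
        a + s * b ≤ c * L := by
  have hm' : (0 : ℝ) < m := by exact_mod_cast hm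
  have hmM' : (m : ℝ) ≤ M := by exact_mod_cast hmM
  have hM' : (0 : ℝ) < M := by linarith
  -- Here `a`, `b`, `e` stand for the log-gains of `g₁`, `g₂` and of both. The regimes differ in the
  -- constraints used: `a ≤ e` and `b ≤ e`; then `0 ≤ a` and `b ≤ e`; then `b ≤ e` alone. For `r ≥
  -- 1/2` the middle regime is empty, so the split on `r` in `dSwitch` disappears.
  by_cases h1 : (m : ℝ) < M / 2
  · refine ⟨1, 2 * r, zero_le_one, le_rfl, ?_, fun a b e L _ hae hbe h => ?_⟩
    · simp only [dSwitch, if_pos h1, ite_self]; ring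
    · have h2 : (M / 2 - m) * a ≤ (M / 2 - m) * e := by gcongr
      have h3 : (M : ℝ) / 2 * b ≤ M / 2 * e := by gcongr
      have h4 : (M : ℝ) / 2 * (a + 1 * b) ≤ M / 2 * (2 * r * L) := by linarith
      exact le_of_mul_le_mul_left h4 (by linarith)
  · rw [not_lt] at h1
    by_cases h2 : (m : ℝ) < M * (1 - r)
    · have hr2 : ¬ 1 / 2 ≤ r := fun h => by nlinarith
      have hMm : (0 : ℝ) < M - m := by nlinarith
      refine ⟨1, r * M / (M - m), zero_le_one, le_rfl, ?_, fun a b e L ha hae hbe h => ?_⟩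
      · simp only [dSwitch, if_neg hr2, if_neg (not_lt.2 h1), if_pos h2]; ring
      · rw [div_mul_eq_mul_div, le_div_iff₀ hMm]
        have h3 : ((M : ℝ) - m) * b ≤ (M - m) * e := by gcongr
        have h4 : ((M : ℝ) - m) * a ≤ m * a := by gcongr; linarith
        linarith
    · refine ⟨(M - m) / m, M * r / m, div_nonneg (by linarith) hm'.le, ?_, ?_,
        fun a b e L ha hae hbe h => ?_⟩
      · rw [div_le_one hm']; linarith
      · have : dSwitch M m r = M * (1 - r) / m := by
          simp only [dSwitch, if_neg (not_lt.2 h1), if_neg h2, ite_self]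
        rw [this]; field_simp; ring
      · rw [div_mul_eq_mul_div, div_mul_eq_mul_div, ← sub_nonneg]
        have h3 : ((M : ℝ) - m) * b ≤ (M - m) * e :=
          mul_le_mul_of_nonneg_left hbe (by linarith)
        have h4 : M * r * L / m - (a + (M - m) * b / m) = (M * (r * L) - m * a - (M - m) * b) / m := by
          field_simp; ring
        rw [h4]
        exact div_nonneg (by linarith) hm'.le

/-- Primal certificate for the linear program whose value is `dSwitch`. -/
lemma exists_dSwitch_primal (hm : 1 ≤ m) (hmM : m ≤ M) (hr0 : 0 ≤ r) (hr1 : r ≤ 1) :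
    ∃ x y : ℝ, 0 ≤ x ∧ x ≤ y ∧ y ≤ 1 ∧ m * x + (M - m) * y ≤ M * r ∧
      dSwitch M m r = 2 - x - y := by
  have hm' : (0 : ℝ) < m := by exact_mod_cast hm
  have hmM' : (m : ℝ) ≤ M := by exact_mod_cast hmM
  have hM' : (0 : ℝ) < M := by linarith
  -- The optimal exponents of `(|g₁|² ρ, |g₂|² ρ)`: both links equally weak; direct link at noise
  -- level; relay link unfaded.
  by_cases h1 : (m : ℝ) < M / 2
  · refine ⟨r, r, hr0, le_rfl, hr1, by linarith, ?_⟩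
    simp only [dSwitch, if_pos h1, ite_self]; ring
  · rw [not_lt] at h1
    by_cases h2 : (m : ℝ) < M * (1 - r)
    · have hr2 : ¬ 1 / 2 ≤ r := fun h => by nlinarith
      have hMm : (0 : ℝ) < M - m := by nlinarith
      refine ⟨0, r * M / (M - m), le_rfl, by positivity, ?_, ?_, ?_⟩
      · rw [div_le_one hMm]; linarith
      · rw [mul_div_cancel₀ _ hMm.ne']; linarith
      · simp only [dSwitch, if_neg hr2, if_neg (not_lt.2 h1), if_pos h2]; ring
    · have : dSwitch M m r = M * (1 - r) / m := by
        simp only [dSwitch, if_neg (not_lt.2 h1), if_neg h2, ite_self]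
      refine ⟨(M * r - M + m) / m, 1, div_nonneg (by linarith) hm'.le, ?_, le_rfl, ?_, ?_⟩
      · rw [div_le_one hm']; nlinarith
      · rw [mul_div_cancel₀ _ hm'.ne']; linarith
      · rw [this]; field_simp; ring

lemma switchOutageProb_decayGE (hT : 1 ≤ T) (hm : 1 ≤ m) (hmM : m ≤ M) (hr0 : 0 ≤ r) :
    DecayGE (switchOutageProb M T m r) (dSwitch M m r : EReal) := by
  obtain ⟨s, c, hs0, hs1, hd, hdual⟩ := exists_dSwitch_dual hm hmM hr0
  have hT' : (0 : ℝ) < T := by exact_mod_cast hT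
  have hc : DecayGE (fun ρ => ENNReal.ofReal (ρ ^ c)) ((-c : ℝ) : EReal) :=
    decayGE_of_eventually_le one_pos (by simp)
  have hint := decayGE_lintegral_invGain.mul (decayGE_lintegral_invGain.rpow hs0)
  rw [← EReal.coe_add] at hint
  have h := hc.mul hint
  rw [← EReal.coe_add] at h
  have he : -c + (1 + s * 1) = dSwitch M m r := by rw [hd]; ring
  rw [he] at h
  refine h.mono ?_
  filter_upwards [eventually_gt_atTop 0] with ρ hρ
  refine le_trans (measure_mono fun g hg => ?_) (chernoff_two_gains hs0 hs1 hρ)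
  have hg' : (m : ℝ) * T * Real.log (1 + ‖g.1‖ ^ 2 * ρ) +
    ((M : ℝ) - m) * T * Real.log (1 + (‖g.1‖ ^ 2 + ‖g.2‖ ^ 2) * ρ) ≤
      M * T * (r * Real.log ρ) := hg
  refine hdual _ _ (Real.log (1 + (‖g.1‖ ^ 2 + ‖g.2‖ ^ 2) * ρ)) _ (log_gain_nonneg hρ.le _)
    (Real.log_le_log (by positivity) ?_) (Real.log_le_log (by positivity) ?_) ?_
  · have : 0 ≤ ‖g.2‖ ^ 2 * ρ := by positivity
    linarith
  · have : 0 ≤ ‖g.1‖ ^ 2 * ρ := by positivity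
    linarith
  · refine le_of_mul_le_mul_left ?_ hT'
    linarith

lemma decayLE_sq_norm_le {k x : ℝ} (hk : 0 < k) (hx : x ≤ 1) :
    DecayLE (fun ρ => complexNormal 1 {z | ‖z‖ ^ 2 ≤ k * ρ ^ (x - 1)}) ((1 - x : ℝ) : EReal) := by
  refine decayLE_of_eventually_le (k := Real.exp (-k) * k) (by positivity) ?_
  filter_upwards [eventually_ge_atTop 1] with ρ hρ
  have h0 : 0 < ρ := by linarith
  refine le_trans (ENNReal.ofReal_le_ofReal ?_) (le_complexNormal_sq_norm_le (by positivity))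
  have h1 : ρ ^ (x - 1) ≤ 1 := Real.rpow_le_one_of_one_le_of_nonpos hρ (by linarith)
  have h2 : k * ρ ^ (x - 1) ≤ k := mul_le_of_le_one_right hk.le h1
  rw [neg_sub, mul_assoc]
  gcongr

/-- The information carried by the `m`-switch channel on a box of small gains; the second channel
has its gain doubled. -/
lemma switch_info_le_of_box (hmM : m ≤ M) {x y : ℝ} (hx : 0 ≤ x) (hxy : x ≤ y) {ρ : ℝ}
    (hρ : 1 ≤ ρ) {g₁ g₂ : ℂ} (h1 : ‖g₁‖ ^ 2 ≤ ρ ^ (x - 1)) (h2 : ‖g₂‖ ^ 2 ≤ ρ ^ (y - 1)) :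
    m * Real.log (1 + ‖g₁‖ ^ 2 * ρ) + (M - m) * Real.log (1 + 2 * (‖g₁‖ ^ 2 + ‖g₂‖ ^ 2) * ρ) ≤
      M * Real.log 5 + (m * x + (M - m) * y) * Real.log ρ := by
  have h0 : 0 < ρ := by linarith
  have hmM' : (m : ℝ) ≤ M := by exact_mod_cast hmM
  have hx1 : ‖g₁‖ ^ 2 * ρ ≤ ρ ^ x := by
    rw [Real.rpow_sub_one h0.ne', le_div_iff₀ h0] at h1; exact h1
  have hy1 : ‖g₂‖ ^ 2 * ρ ≤ ρ ^ y := by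
    rw [Real.rpow_sub_one h0.ne', le_div_iff₀ h0] at h2; exact h2
  have hxy' : ρ ^ x ≤ ρ ^ y := Real.rpow_le_rpow_of_exponent_le hρ hxy
  have hx2 : 1 ≤ ρ ^ x := Real.one_le_rpow hρ hx
  -- The constant 5 comes from `1 + 2 (ρ ^ x + ρ ^ y) ≤ 5 ρ ^ y`.
  have hlog : ∀ z w : ℝ, 0 < w → w ≤ 5 * ρ ^ z → Real.log w ≤ Real.log 5 + z * Real.log ρ := by
    intro z w hw hz
    rw [← Real.log_rpow h0, ← Real.log_mul (by norm_num) (by positivity)]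
    exact Real.log_le_log hw hz
  have hA := hlog x (1 + ‖g₁‖ ^ 2 * ρ) (by positivity) (by linarith)
  have hB := hlog y (1 + 2 * (‖g₁‖ ^ 2 + ‖g₂‖ ^ 2) * ρ) (by positivity) (by linarith)
  have hA' := mul_le_mul_of_nonneg_left hA (Nat.cast_nonneg m : (0 : ℝ) ≤ m)
  have hB' := mul_le_mul_of_nonneg_left hB (sub_nonneg.2 hmM')
  linarith

lemma switchOutageProb_decayLE (hm : 1 ≤ m) (hmM : m ≤ M) (hr0 : 0 < r) (hr1 : r ≤ 1) :
    DecayLE (switchOutageProb M T m r) (dSwitch M m r : EReal) := by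
  have hM' : (0 : ℝ) < M := by exact_mod_cast (show 0 < M by omega)
  have hmM' : (m : ℝ) ≤ M := by exact_mod_cast hmM
  obtain ⟨x, y, hx, hxy, hy, hcon, hd⟩ := exists_dSwitch_primal hm hmM hr0.le hr1
  rw [hd]
  -- Scaling the optimum by `1 - η` costs at most `2 η` in the exponent and frees at least `M r η`
  -- of rate, which absorbs `M log 5` for large `ρ`.
  refine decayLE_of_forall_add (k := 2) two_pos fun η h0 h1 => ?_
  have hx' : 0 ≤ (1 - η) * x := mul_nonneg (by linarith) hx
  have hxy' : (1 - η) * x ≤ (1 - η) * y := mul_le_mul_of_nonneg_left hxy (by linarith)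
  have hy' : (1 - η) * y ≤ 1 := by nlinarith
  have hbox := (decayLE_sq_norm_le one_pos (hxy'.trans hy')).mul (decayLE_sq_norm_le one_pos hy')
  rw [← EReal.coe_add] at hbox
  refine (hbox.mono_exponent (EReal.coe_le_coe_iff.2 (by nlinarith))).mono ?_
  have hlt : 0 < M * r - (m * ((1 - η) * x) + (M - m) * ((1 - η) * y)) := by
    have : 0 < M * r * η := by positivity
    have h2 := mul_le_mul_of_nonneg_left hcon (show 0 ≤ 1 - η by linarith)
    nlinarith
  filter_upwards [eventually_ge_atTop 1, Real.tendsto_log_atTop.eventually_ge_atTop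
    (M * Real.log 5 / (M * r - (m * ((1 - η) * x) + (M - m) * ((1 - η) * y))))] with ρ hρ hlog
  rw [div_le_iff₀ hlt] at hlog
  rw [← Measure.prod_prod]
  refine measure_mono ?_
  rintro ⟨g₁, g₂⟩ ⟨hg₁, hg₂⟩
  simp only [one_mul, Set.mem_ofPred_eq] at hg₁ hg₂
  have hinfo := switch_info_le_of_box hmM hx' hxy' hρ hg₁ hg₂
  have hmono : Real.log (1 + (‖g₁‖ ^ 2 + ‖g₂‖ ^ 2) * ρ) ≤
      Real.log (1 + 2 * (‖g₁‖ ^ 2 + ‖g₂‖ ^ 2) * ρ) := by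
    refine Real.log_le_log (by positivity) ?_
    have : 0 ≤ (‖g₁‖ ^ 2 + ‖g₂‖ ^ 2) * ρ := by positivity
    linarith
  have hmono' := mul_le_mul_of_nonneg_left hmono (sub_nonneg.2 hmM')
  have hfin : m * Real.log (1 + ‖g₁‖ ^ 2 * ρ) +
      (M - m) * Real.log (1 + (‖g₁‖ ^ 2 + ‖g₂‖ ^ 2) * ρ) ≤ M * (r * Real.log ρ) := by linarith
  have hfinT := mul_le_mul_of_nonneg_left hfin (Nat.cast_nonneg T : (0 : ℝ) ≤ T)
  rw [Set.mem_ofPred_eq, switchInfo]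
  linarith

end SwitchOutage

/-! ### Outage exponent of the random switch channel. -/

section OutageProb

variable {M T : ℕ} {sw sv : ℝ≥0} {r : ℝ}

lemma outageProb_decay (hM : 1 ≤ M) (hT : 1 ≤ T) (hsw : 0 < sw) (hsv : 0 < sv) (hr0 : 0 < r)
    (hr1 : r ≤ 1) :
    DecayGE (outageProb M T sw sv r) (dOut M r) ∧ DecayLE (outageProb M T sw sv r) (dOut M r) := by
  constructor
  · have hsum := DecayGE.sum (s := Finset.Icc 1 M)
      (P := fun m ρ => timeProb M sw sv m r ρ * switchOutageProb M T m r ρ)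
      (d := fun m => dBar M m r + (dSwitch M m r : EReal)) fun m hm => by
        obtain ⟨hm1, hmM⟩ := Finset.mem_Icc.1 hm
        exact (timeProb_decay hM hsw hsv hr0 hr1 hm1 hmM).1.mul
          (switchOutageProb_decayGE hT hm1 hmM hr0.le)
    refine hsum.mono ?_
    filter_upwards [eventually_ge_atTop 1] with ρ hρ
    have hl := Real.log_nonneg hρ
    calc outageProb M T sw sv r ρ
        ≤ (complexNormal 1).prod ((complexNormal 1).prod (complexNormal 1))
          (⋃ m ∈ Finset.Icc 1 M,
            {h | outageTime M (r * Real.log ρ) (ρ * sw / sv) h = m} ×ˢ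
            {g : ℂ × ℂ | switchInfo M T m ρ g.1 g.2 ≤ (M : ℝ) * T * (r * Real.log ρ)}) := by
          refine measure_mono fun c hc => ?_
          refine Set.mem_biUnion (x := outageTime M (r * Real.log ρ) (ρ * sw / sv) c.1)
            (Finset.mem_coe.2 (Finset.mem_Icc.2 ⟨?_, outageTime_le_self _ _ _ _⟩)) ⟨rfl, hc⟩
          refine le_outageTime hM (by positivity) ?_
          rw [Nat.cast_one, sub_self, zero_mul]
          positivity
      _ ≤ _ := by
          refine (measure_biUnion_finset_le _ _).trans (Finset.sum_le_sum fun m _ => ?_)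
          rw [Measure.prod_prod]
          rfl
  · intro c hc
    obtain ⟨m, hm⟩ := iInf_lt_iff.1 hc
    obtain ⟨hmem, hm⟩ := iInf_lt_iff.1 hm
    obtain ⟨hm1, hmM⟩ := Finset.mem_Icc.1 hmem
    have h := (timeProb_decay hM hsw hsv hr0 hr1 hm1 hmM).2.mul
      (switchOutageProb_decayLE (T := T) hm1 hmM hr0 hr1)
    filter_upwards [h c hm] with ρ hρ
    refine hρ.trans ?_
    rw [timeProb, switchOutageProb, ← Measure.prod_prod]
    refine measure_mono ?_
    rintro ⟨h, g₁, g₂⟩ ⟨h1, h2⟩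
    have h1' : outageTime M (r * Real.log ρ) (ρ * sw / sv) h = m := h1
    rw [Set.mem_ofPred_eq, h1']
    exact h2

end OutageProb

/-! ### Converse: lower bounds on the error probability of any family of schemes. -/

section Converse

variable {M T m : ℕ} {sw sv : ℝ≥0} {C : (ρ : ℝ) → Scheme M T sw sv ρ} {r : ℝ}

lemma Scheme.log_two_le_log_K {ρ : ℝ} (C : Scheme M T sw sv ρ) : Real.log 2 ≤ Real.log C.K :=
  Real.log_le_log two_pos (by exact_mod_cast C.two_le_K)

lemma Scheme.log_K_eq {ρ : ℝ} (C : Scheme M T sw sv ρ) (hM : 1 ≤ M) (hT : 1 ≤ T) :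
    Real.log C.K = M * T * C.rate := by
  have : (0 : ℝ) < M := by exact_mod_cast hM
  have : (0 : ℝ) < T := by exact_mod_cast hT
  rw [Scheme.rate]
  field_simp

/-- The error probability of a family of schemes decays no faster than the probability of a box of
small gains on which no scheme of this rate works. -/
lemma errorProb_decayLE_of_box (hM : 1 ≤ M) (hT : 1 ≤ T) (hsw : 0 < sw) (hsv : 0 < sv)
    (hrate : Tendsto (fun ρ => (C ρ).rate / Real.log ρ) atTop (𝓝 r)) (hm : 1 ≤ m) (hmM : m ≤ M)
    {x y z : ℝ} (hx : 0 ≤ x) (hxy : x ≤ y) (hy : y ≤ 1) (hz0 : 0 ≤ z) (hz1 : z ≤ 1)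
    (hxyr : m * x + (M - m) * y < M * r) (hzr : ((m : ℝ) - 1) * z < M * r) :
    DecayLE (fun ρ => (C ρ).errorProb) ((3 - x - y - z : ℝ) : EReal) := by
  have hM' : (0 : ℝ) < M := by exact_mod_cast hM
  have hT' : (0 : ℝ) < T := by exact_mod_cast hT
  have hm' : (1 : ℝ) ≤ m := by exact_mod_cast hm
  have hmM' : (m : ℝ) ≤ M := by exact_mod_cast hmM
  have h1 : (0 : ℝ) < sw := hsw
  have h2 : (0 : ℝ) < sv := hsv
  set κ := (sv : ℝ) / sw with hκ
  have hκ0 : 0 < κ := by positivity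
  set A := (m : ℝ) * x + (M - m) * y with hA
  have hA0 : 0 ≤ A := by
    have := mul_nonneg (sub_nonneg.2 hmM') (hx.trans hxy)
    positivity
  -- With `A < r₂ < r₁ < M r`, eventually `log K ≥ T r₁ log ρ` while the information plus constants
  -- is at most `T r₂ log ρ`. The probability of a correct decision is then at most `r₂ / r₁ = 1 -
  -- δ`.
  obtain ⟨r₁, hr₁, hr₁r⟩ := exists_between (max_lt hxyr hzr)
  obtain ⟨r₂, hr₂, hr₂r⟩ := exists_between ((le_max_left _ _).trans_lt hr₁)
  have hzr₁ : ((m : ℝ) - 1) * z < r₁ := (le_max_right _ _).trans_lt hr₁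
  have hr₁0 : 0 < r₁ := by linarith
  set δ := 1 - r₂ / r₁ with hδ
  have hδ0 : 0 < δ := by
    rw [hδ, sub_pos, div_lt_one hr₁0]; exact hr₂r
  have hG1 := decayLE_sq_norm_le one_pos (hxy.trans hy)
  have hG2 := decayLE_sq_norm_le one_pos hy
  have hH := decayLE_sq_norm_le hκ0 hz1
  have hc : DecayLE (fun _ => ENNReal.ofReal δ) ((0 : ℝ) : EReal) :=
    decayLE_of_eventually_le hδ0 (by simp)
  have hbox := ((hc.mul hG2).mul hG1).mul hH
  simp only [← EReal.coe_add] at hbox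
  have he : 0 + (1 - y) + (1 - x) + (1 - z) = 3 - x - y - z := by ring
  rw [he] at hbox
  refine hbox.mono ?_
  have hrM : r₁ / M < r := by rw [div_lt_iff₀ hM']; linarith
  filter_upwards [eventually_gt_atTop 1, hrate.eventually_const_lt hrM,
    Real.tendsto_log_atTop.eventually_ge_atTop
      (((m : ℝ) - 1) * Real.log 2 / (r₁ - ((m : ℝ) - 1) * z)),
    Real.tendsto_log_atTop.eventually_ge_atTop
      ((T * (M * Real.log 5) + Real.log (1 + (M + 1 - m))) / (T * (r₂ - A)))] with
    ρ hρ hR hlogz hlogA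
  have h0 : 0 < ρ := by linarith
  have hl := Real.log_pos hρ
  rw [div_le_iff₀ (by linarith)] at hlogz
  rw [div_le_iff₀ (mul_pos hT' (by linarith))] at hlogA
  rw [div_lt_div_iff₀ hM' hl] at hR
  have hK := (C ρ).log_K_eq hM hT
  have hKpos : 0 < Real.log (C ρ).K := (Real.log_pos one_lt_two).trans_le (C ρ).log_two_le_log_K
  refine (C ρ).le_errorProb (measurableSet_sq_norm_le _) (measurableSet_sq_norm_le _)
    (measurableSet_sq_norm_le _) fun h hh g₁ hg₁ g₂ hg₂ => ?_
  simp only [one_mul, Set.mem_ofPred_eq] at hh hg₁ hg₂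
  have hout : m ≤ outageTime M (Real.log (C ρ).K / ((M : ℝ) * T)) (ρ * sw / sv) h := by
    refine le_outageTime hmM (by positivity) ?_
    have hle : Real.log (1 + ‖h‖ ^ 2 * (ρ * sw / sv)) ≤ Real.log 2 + z * Real.log ρ := by
      rw [← Real.log_rpow h0, ← Real.log_mul two_ne_zero (by positivity), relaySnr_eq hsw hsv, ← hκ]
      refine Real.log_le_log (by positivity) ?_
      have : ‖h‖ ^ 2 * (ρ / κ) ≤ ρ ^ z := by
        calc ‖h‖ ^ 2 * (ρ / κ) ≤ κ * ρ ^ (z - 1) * (ρ / κ) := by gcongr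
          _ = ρ ^ z := by rw [Real.rpow_sub_one h0.ne']; field_simp
      have := Real.one_le_rpow hρ.le hz0
      linarith
    have := mul_le_mul_of_nonneg_left hle (show 0 ≤ (m : ℝ) - 1 by linarith)
    have hr : Real.log (C ρ).K / ((M : ℝ) * T) = (C ρ).rate := rfl
    rw [hr]
    linarith
  -- The choice `l = log K` cancels `K`, leaving the constant `log (1 + (M + 1 - m))`.
  have hfano := (C ρ).fano hsw h0.le h g₁ g₂ hmM hout hKpos.le
  have hKc : (0 : ℝ) < (C ρ).K := by exact_mod_cast Nat.pos_of_ne_zero (C ρ).K_ne_zero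
  rw [Real.exp_log hKc, mul_div_cancel_left₀ _ hKc.ne'] at hfano
  have hinfo := mul_le_mul_of_nonneg_left (switch_info_le_of_box hmM hx hxy hρ.le hg₁ hg₂) hT'.le
  refine le_of_mul_le_mul_left (hfano.trans ?_) hKpos
  have hδK : T * r₂ * Real.log ρ ≤ Real.log (C ρ).K * (1 - δ) := by
    have : 1 - δ = r₂ / r₁ := by rw [hδ]; ring
    rw [this, hK, ← mul_div_assoc, le_div_iff₀ hr₁0]
    have hr₂0 : 0 < r₂ := by linarith
    have := mul_le_mul_of_nonneg_left hR.le (by positivity : 0 ≤ T * r₂)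
    linarith
  linarith

/-- `z` is the exponent of the source-relay SNR, and `1 - z` its cost. An inequality suffices: an
unfaded link, `z = 1`, already serves when `dBar` is `0` or `⊤`. -/
lemma exists_dBar_primal (hM : 1 ≤ M) (hm : 1 ≤ m) (hr0 : 0 ≤ r) :
    ∃ z : ℝ, 0 ≤ z ∧ z ≤ 1 ∧ ((m : ℝ) - 1) * z ≤ M * r ∧ ((1 - z : ℝ) : EReal) ≤ dBar M m r := by
  have hM' : (0 : ℝ) < M := by exact_mod_cast hM
  rw [dBar]
  split_ifs with h1 h2
  · have hm' : (0 : ℝ) < (m : ℝ) - 1 := by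
      have : (2 : ℝ) ≤ m := by exact_mod_cast (show 2 ≤ m by omega)
      linarith
    refine ⟨M * r / ((m : ℝ) - 1), by positivity, ?_, (mul_div_cancel₀ _ hm'.ne').le, le_rfl⟩
    have := h1.2
    rw [le_div_iff₀ hM'] at this
    rw [div_le_one hm']
    linarith
  all_goals
    refine ⟨1, zero_le_one, le_rfl, ?_, by simp⟩
    by_cases hm1 : m = 1
    · subst hm1
      simp only [Nat.cast_one, sub_self, zero_mul]
      positivity
    · have := not_le.1 fun h => h1 ⟨hm1, h⟩
      rw [div_lt_iff₀ hM'] at this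
      linarith

lemma errorProb_decayLE (hM : 1 ≤ M) (hT : 1 ≤ T) (hsw : 0 < sw) (hsv : 0 < sv)
    (hrate : Tendsto (fun ρ => (C ρ).rate / Real.log ρ) atTop (𝓝 r)) (hr0 : 0 < r) (hr1 : r ≤ 1)
    (hm : 1 ≤ m) (hmM : m ≤ M) :
    DecayLE (fun ρ => (C ρ).errorProb) (dBar M m r + (dSwitch M m r : EReal)) := by
  have hM' : (0 : ℝ) < M := by exact_mod_cast hM
  obtain ⟨x, y, hx, hxy, hy, hcon, hd⟩ := exists_dSwitch_primal hm hmM hr0.le hr1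
  obtain ⟨z, hz0, hz1, hzr, hzd⟩ := exists_dBar_primal hM hm hr0.le
  have hbox : DecayLE (fun ρ => (C ρ).errorProb) ((3 - x - y - z : ℝ) : EReal) := by
    refine decayLE_of_forall_add (k := 3) three_pos fun η h0 h1 => ?_
    have hη : 0 < 1 - η := by linarith
    have hpos : 0 < M * r * η := by positivity
    refine (errorProb_decayLE_of_box hM hT hsw hsv hrate hm hmM (mul_nonneg hη.le hx)
      (mul_le_mul_of_nonneg_left hxy hη.le) (by nlinarith) (mul_nonneg hη.le hz0) (by nlinarith)
      ?_ ?_).mono_exponent (EReal.coe_le_coe_iff.2 (by nlinarith))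
    · have := mul_le_mul_of_nonneg_left hcon hη.le
      linarith
    · have := mul_le_mul_of_nonneg_left hzr hη.le
      linarith
  refine hbox.mono_exponent ?_
  calc ((3 - x - y - z : ℝ) : EReal) = ((1 - z : ℝ) : EReal) + ((dSwitch M m r : ℝ) : EReal) := by
        rw [hd, ← EReal.coe_add]; congr 1; ring
    _ ≤ _ := by gcongr

/-- At any rate, outages of the source-relay and source-destination links bound the decay of the
error probability. -/
lemma errorProb_decayLE_of_direct_outage (hM : 1 ≤ M) (hT : 1 ≤ T) (hsw : 0 < sw) (hsv : 0 < sv)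
    {z : ℝ} (hz1 : z ≤ 1) (hMz : M = 1 ∨ z = 0) :
    DecayLE (fun ρ => (C ρ).errorProb) ((2 - z : ℝ) : EReal) := by
  have hM' : (1 : ℝ) ≤ M := by exact_mod_cast hM
  have hT' : (0 : ℝ) < T := by exact_mod_cast hT
  have h1 : (0 : ℝ) < sw := hsw
  have h2 : (0 : ℝ) < sv := hsv
  have hlog2 := Real.log_pos one_lt_two
  set κ := (sv : ℝ) / sw with hκ
  have hκ0 : 0 < κ := by positivity
  -- Chosen so that the direct link carries at most `log 2 / 2` nats over the block, half of what
  -- two messages require.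
  set k := Real.exp (Real.log 2 / (2 * (M * T))) - 1 with hk
  have hk0 : 0 < k := by
    rw [hk, sub_pos, Real.one_lt_exp_iff]; positivity
  have hlogk : M * T * Real.log (1 + k) = Real.log 2 / 2 := by
    rw [hk, add_sub_cancel, Real.log_exp]; field_simp
  have hG1 := decayLE_sq_norm_le hk0 zero_le_one
  have hH := decayLE_sq_norm_le (mul_pos hκ0 hk0) hz1
  -- The tilt `l = log K` is too weak for `K = 2`; with `l = log K + 2` the worst case is `log 2 / 2
  -- + 9 / 4 ≤ (97 / 100) (log 2 + 2)`.
  have hc : DecayLE (fun _ => ENNReal.ofReal (3 / 100)) ((0 : ℝ) : EReal) :=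
    decayLE_of_eventually_le (k := 3 / 100) (by norm_num) (by simp)
  have hbox := (hc.mul hG1).mul hH
  simp only [← EReal.coe_add] at hbox
  have he : 0 + (1 - 0) + (1 - z) = 2 - z := by ring
  rw [he] at hbox
  refine hbox.mono ?_
  filter_upwards [eventually_gt_atTop 1] with ρ hρ
  have h0 : 0 < ρ := by linarith
  have hK := (C ρ).log_two_le_log_K
  have herr := (C ρ).le_errorProb (measurableSet_sq_norm_le (κ * k * ρ ^ (z - 1)))
    (measurableSet_sq_norm_le (k * ρ ^ ((0 : ℝ) - 1))) MeasurableSet.univ (c := 3 / 100)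
    fun h hh g₁ hg₁ g₂ _ => ?_
  · rwa [measure_univ, mul_one] at herr
  rw [Set.mem_ofPred_eq] at hh hg₁
  have hout : M ≤ outageTime M (Real.log (C ρ).K / ((M : ℝ) * T)) (ρ * sw / sv) h := by
    refine le_outageTime le_rfl (by positivity) ?_
    rcases hMz with rfl | rfl
    · rw [Nat.cast_one, sub_self, zero_mul]
      have : 0 ≤ Real.log (C ρ).K := hlog2.le.trans hK
      positivity
    · have hle : Real.log (1 + ‖h‖ ^ 2 * (ρ * sw / sv)) ≤ Real.log (1 + k) := by
        rw [relaySnr_eq hsw hsv, ← hκ]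
        refine Real.log_le_log (by positivity) ?_
        have : ‖h‖ ^ 2 * (ρ / κ) ≤ k := by
          calc ‖h‖ ^ 2 * (ρ / κ) ≤ κ * k * ρ ^ ((0 : ℝ) - 1) * (ρ / κ) := by gcongr
            _ = k := by rw [Real.rpow_sub_one h0.ne', Real.rpow_zero]; field_simp
        linarith
      have hlk : 0 ≤ Real.log (1 + k) := Real.log_nonneg (by linarith)
      have hR : (M : ℝ) * (Real.log (C ρ).K / ((M : ℝ) * T)) = Real.log (C ρ).K / T := by
        field_simp
      rw [hR, le_div_iff₀ hT']
      calc ((M : ℝ) - 1) * Real.log (1 + ‖h‖ ^ 2 * (ρ * sw / sv)) * T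
          ≤ M * Real.log (1 + k) * T := by
            have := log_gain_nonneg (show 0 ≤ ρ * sw / sv by positivity) h
            gcongr
            linarith
        _ = Real.log 2 / 2 := by rw [← hlogk]; ring
        _ ≤ _ := by linarith
  have hfano := (C ρ).fano hsw h0.le h g₁ g₂ le_rfl hout
    (l := Real.log (C ρ).K + 2) (by linarith)
  have hKc : (0 : ℝ) < (C ρ).K := by exact_mod_cast Nat.pos_of_ne_zero (C ρ).K_ne_zero
  have hN : Real.exp (Real.log (C ρ).K + 2) * ((M : ℝ) + 1 - M) / (C ρ).K = Real.exp 2 := by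
    rw [Real.exp_add, Real.exp_log hKc]; field_simp; ring
  have hlogN : Real.log (1 + Real.exp 2) ≤ 9 / 4 := by
    have h3 : (1 : ℝ) + Real.exp 2 = Real.exp 2 * (1 + Real.exp (-2)) := by
      rw [mul_add, ← Real.exp_add]; simp [add_comm]
    have h4 : Real.log (1 + Real.exp (-2)) ≤ Real.exp (-2) := by
      have := Real.log_le_sub_one_of_pos (show 0 < 1 + Real.exp (-2) by positivity)
      linarith
    have h5 : Real.exp (-2) ≤ 1 / 4 := by
      rw [Real.exp_neg, one_div]
      refine inv_anti₀ (by norm_num) ?_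
      have h6 : (2 : ℝ) ≤ Real.exp 1 := by
        have := Real.add_one_le_exp (1 : ℝ)
        linarith
      have h7 : Real.exp 2 = Real.exp 1 * Real.exp 1 := by rw [← Real.exp_add]; norm_num
      rw [h7]; nlinarith
    rw [h3, Real.log_mul (Real.exp_pos _).ne' (by positivity), Real.log_exp]
    linarith
  have hD : (M : ℝ) * T * Real.log (1 + ‖g₁‖ ^ 2 * ρ) ≤ Real.log 2 / 2 := by
    rw [← hlogk]
    have : ‖g₁‖ ^ 2 * ρ ≤ k := by
      calc ‖g₁‖ ^ 2 * ρ ≤ k * ρ ^ ((0 : ℝ) - 1) * ρ := by gcongr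
        _ = k := by rw [Real.rpow_sub_one h0.ne', Real.rpow_zero]; field_simp
    gcongr
  rw [hN, sub_self, zero_mul, zero_mul, add_zero] at hfano
  refine le_of_mul_le_mul_left (hfano.trans ?_) (show 0 < Real.log (C ρ).K + 2 by linarith)
  have := Real.log_two_gt_d9
  linarith

/-- At `r = 0` shrinking the exponents frees no rate. Instead `dBar + dSwitch` is at least `1` if `M
= 1` and at least `2` otherwise: the exponents of an outage of the direct link alone, and of both
the direct and source-relay links. -/
lemma errorProb_decayLE_zero (hM : 1 ≤ M) (hT : 1 ≤ T) (hsw : 0 < sw) (hsv : 0 < sv)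
    (hm : 1 ≤ m) (hmM : m ≤ M) :
    DecayLE (fun ρ => (C ρ).errorProb) (dBar M m 0 + (dSwitch M m 0 : EReal)) := by
  have hm' : (1 : ℝ) ≤ m := by exact_mod_cast hm
  have hM' : (1 : ℝ) ≤ M := by exact_mod_cast hM
  have hsw1 : 1 ≤ dSwitch M m 0 := by
    rw [dSwitch, if_neg (by norm_num)]
    split_ifs
    · norm_num
    · norm_num
    · rw [sub_zero, mul_one, one_le_div (by linarith)]
      exact_mod_cast hmM
  have hbar : dBar M m 0 = if m = 1 then 0 else 1 := by
    rw [dBar]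
    by_cases h1 : m = 1
    · rw [if_neg (by simp [h1]), if_pos (by positivity), if_pos h1]
    · rw [if_pos ⟨h1, div_nonneg (by linarith) (by linarith)⟩, if_neg h1]
      simp
  by_cases hM1 : M = 1
  · have h := errorProb_decayLE_of_direct_outage (C := C) hM hT hsw hsv le_rfl (Or.inl hM1)
    refine h.mono_exponent ?_
    rw [hbar, if_pos (by omega), zero_add]
    exact EReal.coe_le_coe_iff.2 (by linarith)
  · have h := errorProb_decayLE_of_direct_outage (C := C) hM hT hsw hsv zero_le_one (Or.inr rfl)
    refine h.mono_exponent ?_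
    rw [hbar]
    by_cases hm1 : m = 1
    · rw [if_pos hm1, zero_add]
      refine EReal.coe_le_coe_iff.2 ?_
      have h2 : (2 : ℝ) ≤ M := by exact_mod_cast (show 2 ≤ M by omega)
      subst hm1
      rw [dSwitch, if_neg (by norm_num)]
      split_ifs with h3 h4
      · norm_num
      · norm_num
      · exact absurd (by push_cast; linarith) h4
    · rw [if_neg hm1, ← EReal.coe_one, ← EReal.coe_add]
      exact EReal.coe_le_coe_iff.2 (by linarith)

lemma genieDmt_le_dOut (hM : 1 ≤ M) (hT : 1 ≤ T) (hsw : 0 < sw) (hsv : 0 < sv) (hr0 : 0 ≤ r)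
    (hr1 : r ≤ 1) : genieDmt M T sw sv r ≤ dOut M r := by
  refine sSup_le ?_
  rintro d ⟨C, hrate, herr⟩
  refine le_iInf₂ fun m hm => ?_
  obtain ⟨hm1, hmM⟩ := Finset.mem_Icc.1 hm
  refine le_of_tendsto_snrExponent herr ?_
  rcases hr0.eq_or_lt with rfl | hr0
  · exact errorProb_decayLE_zero hM hT hsw hsv hm1 hmM
  · exact errorProb_decayLE hM hT hsw hsv hrate hr0 hr1 hm1 hmM

lemma dmt_le_genieDmt : dmt M T sw sv r ≤ genieDmt M T sw sv r :=
  sSup_le_sSup fun _ ⟨C, _, hC⟩ => ⟨C, hC⟩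

end Converse

end DDF

end

theorem theorem1 (M T : ℕ) (hM : 1 ≤ M) (hT : 1 ≤ T) (sw sv : ℝ≥0) (hsw : 0 < sw) (hsv : 0 < sv)
    (r : ℝ) (hr0 : 0 ≤ r) (hr1 : r ≤ 1) :
    -- the tradeoff is bounded by `d_out`, even if the destination is told the decision time
    DDF.dmt M T sw sv r ≤ DDF.dOut M r ∧
    DDF.genieDmt M T sw sv r ≤ DDF.dOut M r ∧
    -- the explicit functions are the exponents of the corresponding probabilities
    (0 < r →
      (∀ m ∈ Finset.Icc 1 M,
        Tendsto (fun ρ => DDF.snrExponent ρ (DDF.timeProb M sw sv m r ρ)) atTop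
          (𝓝 (DDF.dBar M m r)) ∧
        Tendsto (fun ρ => DDF.snrExponent ρ (DDF.switchOutageProb M T m r ρ)) atTop
          (𝓝 (DDF.dSwitch M m r : EReal))) ∧
      Tendsto (fun ρ => DDF.snrExponent ρ (DDF.outageProb M T sw sv r ρ)) atTop
        (𝓝 (DDF.dOut M r))) := by
  have hgenie := DDF.genieDmt_le_dOut hM hT hsw hsv hr0 hr1
  refine ⟨DDF.dmt_le_genieDmt.trans hgenie, hgenie, fun hr => ⟨fun m hm => ?_, ?_⟩⟩
  · obtain ⟨hm1, hmM⟩ := Finset.mem_Icc.1 hm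
    have htime := DDF.timeProb_decay hM hsw hsv hr hr1 hm1 hmM
    exact ⟨DDF.tendsto_snrExponent htime.1 htime.2,
      DDF.tendsto_snrExponent (DDF.switchOutageProb_decayGE hT hm1 hmM hr0)
        (DDF.switchOutageProb_decayLE hm1 hmM hr hr1)⟩
  · have hout := DDF.outageProb_decay (T := T) hM hT hsw hsv hr hr1
    exact DDF.tendsto_snrExponent hout.1 hout.2
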